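/- **Setting.** Let $K\ge 1$, let $\nu=(\nu_1,\dots,\nu_K)$ be probability distributions on $\mathbb R$ supported in $[0,1]$ with means $\mu_1,\dots,\mu_K$, and put $\mu^*=\max_a\mu_a$, $\Delta_a=\mu^*-\mu_a$. In round $t$ an algorithm plays an arm $A_t$ and receives a reward $R_t$ which, conditionally on the past (including the internal randomness of the algorithm used so far) and on $A_t$, has law $\nu_{A_t}$. Let $N_a(t)=\#\{s\le t: A_s=a\}$ and $\mathrm{Reg}_T=T\mu^*-\mathbb E\big[\sum_{t=1}^T R_t\big]$. Let $\mathrm{Lap}(b)$ be the centred Laplace distribution with scale $b$ (density $\frac1{2b}e^{-|x|/b}$). **AdaP-UCB** with parameters $\alpha>3$ and $\epsilon>0$. Rounds $1,\dots,K$ play each arm once (each of these rounds is an episode of length one). Afterwards the algorithm proceeds in episodes: the episode starting in round $t_\ell$ plays an arm $A\in\operatorname{argmax}_a I_a$ (ties broken arbitrarily) until round $t$ with $N_{A}(t)=2N_{A}(t_\ell-1)$, where $$I_a=\tilde\mu_a+\sqrt{\frac{\alpha\log t_\ell}{2\cdot\frac12N_a(t_\ell-1)}}+\frac{\alpha\log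 t_\ell}{\epsilon\cdot\frac12N_a(t_\ell-1)}$$ and $\tilde\mu_a$ is the private mean of arm $a$, computed once, at the end of the last completed episode in which $a$ was played: the average of the rewards of that episode plus independent noise of law $\mathrm{Lap}\big(\frac{2}{\epsilon N_a(t_\ell-1)}\big)$. **Theorem.** Let $\alpha>3$. (i) For all $K\ge1$, $\epsilon>0$, all $\nu$ as above and every horizon $T\in\mathbb N$ (with $\log 0:=0$), AdaP-UCB satisfies $$\mathrm{Reg}_T\le B_T(\nu):=\frac{3\alpha}{\alpha-3}\sum_{a=1}^K\Delta_a+8\sqrt{\alpha KT\log T}+\frac{16\,\alpha K\log T}{\epsilon}.$$ (ii) This bound is, up to a factor of order $\log T$, the minimax lower bound for $\epsilon$-globally differentially private bandits, $\max\big\{\frac1{27}\sqrt{T(K-1)},\ \frac1{131}\frac{K-1}{\epsilon}\big\}$: there is a constant $C>0$ depending only on $\alpha$ such that for all $K\ge2$, $\epsilon>0$, $T\ge\max\{2,K-1\}$ and all $\nu$ as above, $$B_T(\nu)\le C\,\log T\cdot\max\Big\{\frac1{27}\sqrt{T(K-1)},\ \frac1{131}\frac{K-1}{\epsilon}\Big\}.$$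 -/

import Mathlib

noncomputable section

open MeasureTheory ProbabilityTheory

namespace AdaP

/-! ### The Laplace distribution -/

/-- Density of the centred Laplace distribution with scale `b` (variance `2 * b ^ 2`). -/
def laplacePDF (b x : ℝ) : ℝ := 1 / (2 * b) * Real.exp (-(|x| / b))

/-- The Laplace distribution `Lap(b)`. For a scale `b ≤ 0`, which never occurs below, it is set to
the point mass at `0`. -/
def laplace (b : ℝ) : Measure ℝ :=
  if 0 < b then volume.withDensity (fun x => ENNReal.ofReal (laplacePDF b x))
  else Measure.dirac 0

theorem integral_laplacePDF {b : ℝ} (hb : 0 < b) : ∫ x, laplacePDF b x = 1 := by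
  have h1 : ∫ x : ℝ, Real.exp (-|x|) = 2 := by
    have := integral_comp_abs (f := fun x : ℝ => Real.exp (-x))
    rw [this, integral_exp_neg_Ioi_zero, mul_one]
  have h2 := Measure.integral_comp_div (fun x : ℝ => Real.exp (-|x|)) b
  simp only [abs_div, abs_of_pos hb, h1, smul_eq_mul] at h2
  unfold laplacePDF
  rw [integral_const_mul, h2]
  field_simp

instance (b : ℝ) : IsProbabilityMeasure (laplace b) := by
  unfold laplace
  split_ifs with hb
  · refine ⟨?_⟩
    have hi : Integrable (laplacePDF b) := by
      refine Integrable.of_integral_ne_zero ?_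
      rw [integral_laplacePDF hb]
      exact one_ne_zero
    rw [withDensity_apply _ MeasurableSet.univ, Measure.restrict_univ,
      ← ofReal_integral_eq_lintegral_ofReal hi, integral_laplacePDF hb, ENNReal.ofReal_one]
    refine Filter.Eventually.of_forall fun x => ?_
    simp only [laplacePDF, Pi.zero_apply]
    positivity
  · infer_instance

/-! ### The algorithm

Arms are the elements of `Fin K`. Below, `n` is the number of completed rounds, so the round about
to be played is round `t = n + 1`. -/

/-- A choice of `argmax`, i.e. a rule selecting a maximiser of a vector of indexes, with arbitrary
(measurable) tie breaking. -/
structure ArgmaxRule (K : ℕ) where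
  select : (Fin K → ℝ) → Fin K
  measurable_select : Measurable select
  le_select : ∀ (v : Fin K → ℝ) (a : Fin K), v a ≤ v (select v)

/-- Ties can be broken in favour of the first arm. -/
instance (K : ℕ) [NeZero K] : Nonempty (ArgmaxRule K) := by
  classical
  have hne : ∀ v : Fin K → ℝ, (Finset.univ.filter fun a => ∀ b, v b ≤ v a).Nonempty := by
    intro v
    obtain ⟨a, ha⟩ := Finite.exists_max v
    exact ⟨a, by simpa using ha⟩
  refine ⟨⟨fun v => (Finset.univ.filter fun a => ∀ b, v b ≤ v a).min' (hne v), ?_, ?_⟩⟩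
  · refine measurable_to_countable' fun a => ?_
    have : (fun v : Fin K → ℝ => (Finset.univ.filter fun a => ∀ b, v b ≤ v a).min' (hne v)) ⁻¹' {a}
        = {v | (∀ b, v b ≤ v a) ∧ ∀ c, (∀ b, v b ≤ v c) → a ≤ c} := by
      ext v
      simp [Finset.min'_eq_iff]
    rw [this]
    measurability
  · intro v
    have := Finset.min'_mem _ (hne v)
    simpa using this

/-- The memory of the algorithm between rounds. -/
structure State (K : ℕ) where
  /-- `N_a(t)`: the number of times that arm `a` has been played. -/
  count : Fin K → ℕ
  /-- The private empirical mean released at the end of the last active episode of each arm. -/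
  privMean : Fin K → ℝ
  /-- The arm played in the current episode. -/
  arm : Fin K
  /-- The number of plays of `arm` before the current episode. -/
  start : ℕ
  /-- The current episode lasts until `arm` has been played `goal` times. -/
  goal : ℕ
  /-- The sum of the rewards collected so far in the current episode. -/
  rewardSum : ℝ

variable {K : ℕ}

/-- The index `I_a^ε(t - 1, α)` of arm `a` at the start `t` of an episode. -/
def index (α ε : ℝ) (t : ℕ) (s : State K) (a : Fin K) : ℝ :=
  s.privMean a
    + Real.sqrt (α * Real.log t / (2 * (1 / 2 * (s.count a : ℝ))))
    + α * Real.log t / (ε * (1 / 2 * (s.count a : ℝ)))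

/-- The state of the algorithm before the first round. -/
def initState (K : ℕ) [NeZero K] : State K where
  count := fun _ => 0
  privMean := fun _ => 0
  arm := 0
  start := 0
  goal := 0
  rewardSum := 0

/-- What the algorithm does at the beginning of round `n + 1`. In the first `K` rounds each arm is
played once (an episode of length one). Afterwards the current episode goes on if it is not
finished; otherwise a new episode starts, with an arm of largest index, that lasts until the number
of plays of this arm has doubled. -/
def beginRound (σ : ArgmaxRule K) (α ε : ℝ) (n : ℕ) (s : State K) : State K :=
  if h : n < K then
    { s with arm := ⟨n, h⟩, start := 0, goal := 1, rewardSum := 0 }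
  else if s.count s.arm < s.goal then s
  else
    { s with
      arm := σ.select (index α ε (n + 1) s)
      start := s.count (σ.select (index α ε (n + 1) s))
      goal := 2 * s.count (σ.select (index α ε (n + 1) s))
      rewardSum := 0 }

/-- What the algorithm does at the end of a round with reward `r`. If this round ends the episode,
the mean of the rewards of this episode plus the noise `z` becomes the private mean of the arm. -/
def endRound (s : State K) (r z : ℝ) : State K :=
  { s with
    count := Function.update s.count s.arm (s.count s.arm + 1)
    rewardSum := s.rewardSum + r
    privMean :=
      if s.count s.arm + 1 = s.goal then
        Function.update s.privMean s.arm
          ((s.rewardSum + r) / ((s.goal : ℝ) - (s.start : ℝ)) + z)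
      else s.privMean }

/-- The record of one round: the arm played, the reward, and the privacy noise of the algorithm. -/
abbrev Round (K : ℕ) : Type := Fin K × ℝ × ℝ

/-- The state of the algorithm after the `n` rounds recorded in `h`. -/
def state [NeZero K] (σ : ArgmaxRule K) (α ε : ℝ) : (n : ℕ) → (Fin n → Round K) → State K
  | 0, _ => initState K
  | n + 1, h =>
      endRound (beginRound σ α ε n (state σ α ε n (Fin.init h)))
        (h (Fin.last n)).2.1 (h (Fin.last n)).2.2

/-- The arm played in round `n + 1`. -/
def nextArm [NeZero K] (σ : ArgmaxRule K) (α ε : ℝ) (n : ℕ) (h : Fin n → Round K) : Fin K :=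
  (beginRound σ α ε n (state σ α ε n h)).arm

/-- The number of plays, round `n + 1` included, of the arm played in round `n + 1`. -/
def nextCount [NeZero K] (σ : ArgmaxRule K) (α ε : ℝ) (n : ℕ) (h : Fin n → Round K) : ℕ :=
  (state σ α ε n h).count (nextArm σ α ε n h) + 1

/-! ### Measurability of the algorithm -/

/-- A state that depends measurably on a parameter, field by field. -/
structure MeasState {Ω : Type*} [MeasurableSpace Ω] (f : Ω → State K) : Prop where
  count : Measurable fun ω => (f ω).count
  privMean : Measurable fun ω => (f ω).privMean
  arm : Measurable fun ω => (f ω).arm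
  start : Measurable fun ω => (f ω).start
  goal : Measurable fun ω => (f ω).goal
  rewardSum : Measurable fun ω => (f ω).rewardSum

theorem measurable_apply_arm {Ω β : Type*} [MeasurableSpace Ω] [MeasurableSpace β]
    {f : Ω → Fin K → β} {g : Ω → Fin K} (hf : Measurable f) (hg : Measurable g) :
    Measurable fun ω => f ω (g ω) := by
  have : Measurable fun p : Fin K × Ω => f p.2 p.1 :=
    measurable_from_prod_countable_right fun a => (measurable_pi_apply a).comp hf
  exact this.comp (hg.prodMk measurable_id)

theorem measurable_update_arm {Ω β : Type*} [MeasurableSpace Ω] [MeasurableSpace β]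
    {f : Ω → Fin K → β} {g : Ω → Fin K} {x : Ω → β}
    (hf : Measurable f) (hg : Measurable g) (hx : Measurable x) :
    Measurable fun ω => Function.update (f ω) (g ω) (x ω) := by
  rw [measurable_pi_iff]
  intro a
  simp only [Function.update_apply]
  exact Measurable.ite (hg (measurableSet_singleton a) |>.congr (by ext; simp [eq_comm]))
    hx ((measurable_pi_apply a).comp hf)

theorem MeasState.measurable_index {Ω : Type*} [MeasurableSpace Ω] {f : Ω → State K}
    (hf : MeasState f) (α ε : ℝ) (t : ℕ) : Measurable fun ω => index α ε t (f ω) := by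
  rw [measurable_pi_iff]
  intro a
  have h1 : Measurable fun ω => (f ω).privMean a := (measurable_pi_apply a).comp hf.privMean
  have h2 : Measurable fun ω => ((f ω).count a : ℝ) :=
    measurable_from_nat.comp ((measurable_pi_apply a).comp hf.count)
  unfold index
  fun_prop

theorem MeasState.beginRound {Ω : Type*} [MeasurableSpace Ω] {f : Ω → State K}
    (hf : MeasState f) (σ : ArgmaxRule K) (α ε : ℝ) (n : ℕ) :
    MeasState fun ω => beginRound σ α ε n (f ω) := by
  by_cases h : n < K
  · simp only [AdaP.beginRound, h, dite_true]
    exact ⟨hf.count, hf.privMean, measurable_const, measurable_const, measurable_const,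
      measurable_const⟩
  · have hs : Measurable fun ω => σ.select (index α ε (n + 1) (f ω)) :=
      σ.measurable_select.comp (hf.measurable_index α ε (n + 1))
    have hc := measurable_apply_arm hf.count hs
    have hE : MeasurableSet {ω | (f ω).count (f ω).arm < (f ω).goal} :=
      measurableSet_lt (measurable_apply_arm hf.count hf.arm) hf.goal
    simp only [AdaP.beginRound, h, dite_false]
    refine ⟨?_, ?_, ?_, ?_, ?_, ?_⟩ <;> simp only [apply_ite State.count,
      apply_ite State.privMean, apply_ite State.arm, apply_ite State.start, apply_ite State.goal,
      apply_ite State.rewardSum]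
    · exact Measurable.ite hE hf.count hf.count
    · exact Measurable.ite hE hf.privMean hf.privMean
    · exact Measurable.ite hE hf.arm hs
    · exact Measurable.ite hE hf.start hc
    · exact Measurable.ite hE hf.goal (hc.const_mul 2)
    · exact Measurable.ite hE hf.rewardSum measurable_const

theorem MeasState.endRound {Ω : Type*} [MeasurableSpace Ω] {f : Ω → State K} {r z : Ω → ℝ}
    (hf : MeasState f) (hr : Measurable r) (hz : Measurable z) :
    MeasState fun ω => endRound (f ω) (r ω) (z ω) := by
  have hc := measurable_apply_arm hf.count hf.arm
  have hg : Measurable fun ω => ((f ω).goal : ℝ) := measurable_from_nat.comp hf.goal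
  have hs : Measurable fun ω => ((f ω).start : ℝ) := measurable_from_nat.comp hf.start
  refine ⟨?_, ?_, hf.arm, hf.start, hf.goal, hf.rewardSum.add hr⟩
  · exact measurable_update_arm hf.count hf.arm (hc.add_const 1)
  · exact Measurable.ite (measurableSet_eq_fun (hc.add_const 1) hf.goal)
      (measurable_update_arm hf.privMean hf.arm
        (((hf.rewardSum.add hr).div (hg.sub hs)).add hz)) hf.privMean

theorem measState_state [NeZero K] (σ : ArgmaxRule K) (α ε : ℝ) (n : ℕ) :
    MeasState (state σ α ε n) := by
  induction n with
  | zero =>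
    exact ⟨measurable_const, measurable_const, measurable_const, measurable_const,
      measurable_const, measurable_const⟩
  | succ n ih =>
    have hi : Measurable fun h : Fin (n + 1) → Round K => (Fin.init h : Fin n → Round K) :=
      measurable_pi_iff.2 fun i => measurable_pi_apply i.castSucc
    have ih' : MeasState fun h : Fin (n + 1) → Round K => state σ α ε n (Fin.init h) :=
      ⟨ih.count.comp hi, ih.privMean.comp hi, ih.arm.comp hi, ih.start.comp hi, ih.goal.comp hi,
        ih.rewardSum.comp hi⟩
    exact (ih'.beginRound σ α ε n).endRound (by fun_prop) (by fun_prop)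

theorem measurable_next [NeZero K] (σ : ArgmaxRule K) (α ε : ℝ) (n : ℕ) :
    Measurable fun h => (nextArm σ α ε n h, nextCount σ α ε n h) := by
  have h1 := ((measState_state σ α ε n).beginRound σ α ε n).arm
  exact h1.prodMk ((measurable_apply_arm (measState_state σ α ε n).count h1).add_const 1)

/-! ### Interaction with the environment and regret -/

/-- The law of a round in which arm `p.1` is played for the `p.2`-th time: the reward is drawn from
`ν p.1`, and independently of it the noise is drawn from `Lap(2 / (ε * p.2))`. The algorithm uses
the noise only if the round ends an episode. -/
def roundKernel (ν : Fin K → Measure ℝ) (ε : ℝ) : Kernel (Fin K × ℕ) (Round K) :=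
  Kernel.ofFunOfCountable fun p =>
    (Measure.dirac p.1).prod ((ν p.1).prod (laplace (2 / (ε * (p.2 : ℝ)))))

/-- The conditional law of round `n + 1` given the first `n` rounds. -/
def stepKernel [NeZero K] (σ : ArgmaxRule K) (α ε : ℝ) (ν : Fin K → Measure ℝ) (n : ℕ) :
    Kernel (Fin n → Round K) (Round K) :=
  (roundKernel ν ε).comap (fun h => (nextArm σ α ε n h, nextCount σ α ε n h))
    (measurable_next σ α ε n)

/-- The law of the first `n` rounds of the interaction of AdaP-UCB, with parameters `α` and `ε`,
with the bandit environment `ν`. -/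
def law [NeZero K] (σ : ArgmaxRule K) (α ε : ℝ) (ν : Fin K → Measure ℝ) :
    (n : ℕ) → Measure (Fin n → Round K)
  | 0 => Measure.dirac (fun i => i.elim0)
  | n + 1 => ((law σ α ε ν n).compProd (stepKernel σ α ε ν n)).map
      (fun p => (Fin.snoc p.1 p.2 : Fin (n + 1) → Round K))

instance (ν : Fin K → Measure ℝ) [∀ a, IsProbabilityMeasure (ν a)] (ε : ℝ) :
    IsMarkovKernel (roundKernel ν ε) :=
  ⟨fun p => by
    change IsProbabilityMeasure
      ((Measure.dirac p.1).prod ((ν p.1).prod (laplace (2 / (ε * (p.2 : ℝ))))))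
    infer_instance⟩

instance [NeZero K] (σ : ArgmaxRule K) (α ε : ℝ) (ν : Fin K → Measure ℝ)
    [∀ a, IsProbabilityMeasure (ν a)] (n : ℕ) : IsMarkovKernel (stepKernel σ α ε ν n) := by
  unfold stepKernel
  infer_instance

instance [NeZero K] (σ : ArgmaxRule K) (α ε : ℝ) (ν : Fin K → Measure ℝ)
    [∀ a, IsProbabilityMeasure (ν a)] (n : ℕ) : IsProbabilityMeasure (law σ α ε ν n) := by
  induction n with
  | zero => unfold law; infer_instance
  | succ n ih =>
    unfold law
    refine Measure.isProbabilityMeasure_map (Measurable.aemeasurable ?_)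
    rw [measurable_pi_iff]
    intro i
    refine Fin.lastCases ?_ (fun j => ?_) i
    · simpa using measurable_snd
    · simp only [Fin.snoc_castSucc]
      fun_prop

/-- The mean reward `μ_a` of arm `a`. -/
def mean (ν : Fin K → Measure ℝ) (a : Fin K) : ℝ := ∫ x, x ∂(ν a)

/-- The largest mean reward `μ^*`. -/
def bestMean (ν : Fin K → Measure ℝ) : ℝ := ⨆ a, mean ν a

/-- The suboptimality gap `Δ_a`. -/
def gap (ν : Fin K → Measure ℝ) (a : Fin K) : ℝ := bestMean ν - mean ν a

/-- The regret of AdaP-UCB at horizon `T`: `T μ^* - E[R_1 + ... + R_T]`. -/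
def regret [NeZero K] (σ : ArgmaxRule K) (α ε : ℝ) (ν : Fin K → Measure ℝ) (T : ℕ) : ℝ :=
  T * bestMean ν - ∫ h, ∑ t, (h t).2.1 ∂(law σ α ε ν T)

/-- The minimax lower bound for bandits with `K` arms under `ε`-global differential privacy. -/
def minimaxLowerBound (K T : ℕ) (ε : ℝ) : ℝ :=
  max (1 / 27 * Real.sqrt (T * ((K : ℝ) - 1))) (1 / 131 * (((K : ℝ) - 1) / ε))

end AdaP

end

/-!
Since the number of plays doubles in each episode, the private mean of an arm that has been played
`N = 2 ^ j` times is the noisy average of one block of at least `N / 2` rewards, and this block is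
fixed before any of its rewards is seen. Hoeffding's lemma in the form of a supermartingale along
the block, together with the tail of the Laplace distribution, shows that the private mean leaves
its confidence interval at time `t` with probability at most `2 * t ^ (-α)` on either side.

An episode that starts after `n` rounds has at most `n` rounds, and a union bound over the powers of
two in place of `N` costs a factor `n`; hence the expected number of plays in episodes that start
while the private mean of the played or of the best arm is outside its interval is at most of order
`∑ n ^ 2 * n ^ (-α)`, which is finite because `α > 3`. Any other episode of arm `a` raises the
number of plays to `2 * N` where the gap of `a` is at most twice the radius of the interval for `N`,
so that `gap ν a * (2 * N)` is at most of order `√(α * N * log T) + α * log T / ε`. Summing over the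
arms with the Cauchy–Schwarz inequality gives the regret bound.
-/

noncomputable section

open MeasureTheory ProbabilityTheory

namespace AdaP

variable {K : ℕ}

/-! ### Reward and noise of a single round -/

lemma lintegral_laplacePDF {b : ℝ} (hb : 0 < b) :
    ∫⁻ x, ENNReal.ofReal (laplacePDF b x) = 1 := by
  have h := measure_univ (μ := laplace b)
  rwa [laplace, if_pos hb, withDensity_apply _ MeasurableSet.univ, Measure.restrict_univ] at h

lemma laplacePDF_eq_exp_mul_of_lt {b y κ z : ℝ} (hκ : |κ| = 1) (hy : 0 ≤ y) (hz : y < κ * z) :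
    laplacePDF b z = Real.exp (-(y / b)) * laplacePDF b (z - κ * y) := by
  have abs_z : |z| = κ * z := by
    rw [← one_mul |z|, ← hκ, ← abs_mul, abs_of_nonneg (hy.trans hz.le)]
  have abs_shift : |z - κ * y| = κ * z - y := by
    have hκκ : κ * κ = 1 := by rw [← abs_mul_abs_self, hκ, one_mul]
    rw [← one_mul |_|, ← hκ, ← abs_mul, mul_sub, ← mul_assoc, hκκ, one_mul,
      abs_of_pos (sub_pos.2 hz)]
  rw [laplacePDF, laplacePDF, abs_z, abs_shift, mul_left_comm, ← Real.exp_add]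
  ring_nf

theorem laplace_tail_le {b y κ : ℝ} (hb : 0 < b) (hκ : |κ| = 1) (hy : 0 ≤ y) :
    laplace b {z | y < κ * z} ≤ ENNReal.ofReal (Real.exp (-(y / b))) := by
  have hmeas : MeasurableSet {z : ℝ | y < κ * z} :=
    measurableSet_lt measurable_const (measurable_const.mul measurable_id)
  rw [laplace, if_pos hb, withDensity_apply _ hmeas]
  calc ∫⁻ z in {z : ℝ | y < κ * z}, ENNReal.ofReal (laplacePDF b z)
      ≤ ∫⁻ z in {z : ℝ | y < κ * z}, ENNReal.ofReal (Real.exp (-(y / b))) *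
          ENNReal.ofReal (laplacePDF b (z - κ * y)) := by
        refine setLIntegral_mono' hmeas fun z hz => ?_
        rw [laplacePDF_eq_exp_mul_of_lt hκ hy hz, ENNReal.ofReal_mul (Real.exp_nonneg _)]
    _ ≤ ∫⁻ z, ENNReal.ofReal (Real.exp (-(y / b))) *
          ENNReal.ofReal (laplacePDF b (z - κ * y)) := setLIntegral_le_lintegral _ _
    _ = ENNReal.ofReal (Real.exp (-(y / b))) := by
        rw [lintegral_const_mul' _ _ ENNReal.ofReal_ne_top,
          lintegral_sub_right_eq_self (fun z => ENNReal.ofReal (laplacePDF b z)),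
          lintegral_laplacePDF hb, mul_one]

lemma lintegral_exp_add_mul_le {Ω : Type*} [MeasurableSpace Ω] {μ : Measure Ω} {X : Ω → ℝ}
    {c : NNReal} (hX : HasSubgaussianMGF X c μ) (A θ : ℝ) :
    ∫⁻ ω, ENNReal.ofReal (Real.exp (A + θ * X ω)) ∂μ ≤
      ENNReal.ofReal (Real.exp (A + c * θ ^ 2 / 2)) := by
  simp only [Real.exp_add]
  rw [← ofReal_integral_eq_lintegral_ofReal ((hX.integrable_exp_mul θ).const_mul _)
    (.of_forall fun _ => by positivity), integral_const_mul]
  gcongr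
  exact hX.mgf_le θ

/-- The joint law of the reward and of the noise of a round that is played in state `s`. -/
def rewardNoise (ν : Fin K → Measure ℝ) (ε : ℝ) (s : State K) : Measure (ℝ × ℝ) :=
  (ν s.arm).prod (laplace (2 / (ε * ((s.count s.arm + 1 : ℕ) : ℝ))))

section RewardNoise

variable {ν : Fin K → Measure ℝ} {ε : ℝ} {s : State K}

lemma ae_fst_mem_rewardNoise (hν : ∀ᵐ x ∂(ν s.arm), x ∈ Set.Icc (0 : ℝ) 1) :
    ∀ᵐ p ∂(rewardNoise ν ε s), p.1 ∈ Set.Icc (0 : ℝ) 1 :=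
  Measure.quasiMeasurePreserving_fst.ae hν

variable [∀ a, IsProbabilityMeasure (ν a)]

instance : IsProbabilityMeasure (rewardNoise ν ε s) := by
  unfold rewardNoise; infer_instance

lemma integral_fst_rewardNoise : ∫ p, p.1 ∂(rewardNoise ν ε s) = mean ν s.arm := by
  rw [rewardNoise, integral_fun_fst (fun x : ℝ => x), probReal_univ, one_smul, mean]

lemma hasSubgaussianMGF_reward (hν : ∀ᵐ x ∂(ν s.arm), x ∈ Set.Icc (0 : ℝ) 1) :
    HasSubgaussianMGF (fun p => p.1 - mean ν s.arm) (1 / 4) (rewardNoise ν ε s) := by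
  have h := hasSubgaussianMGF_of_mem_Icc measurable_fst.aemeasurable
    (ae_fst_mem_rewardNoise (ε := ε) hν)
  rw [integral_fst_rewardNoise] at h
  convert h using 1
  simp only [sub_zero, nnnorm_one]
  norm_num

lemma rewardNoise_noise_tail_le (hε : 0 < ε) {y κ : ℝ} (hκ : |κ| = 1) (hy : 0 ≤ y) :
    rewardNoise ν ε s {p | y < κ * p.2} ≤
      ENNReal.ofReal (Real.exp (-(ε * ((s.count s.arm + 1 : ℕ) : ℝ) * y / 2))) := by
  have hmeas : MeasurableSet {z : ℝ | y < κ * z} :=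
    measurableSet_lt measurable_const (measurable_const.mul measurable_id)
  have hsnd := measurePreserving_snd (μ := ν s.arm)
    (ν := laplace (2 / (ε * ((s.count s.arm + 1 : ℕ) : ℝ))))
  refine (hsnd.measure_preimage hmeas.nullMeasurableSet).trans_le
    ((laplace_tail_le (by positivity) hκ hy).trans_eq ?_)
  congr 3
  field_simp

end RewardNoise

/-! ### The law of the interaction -/

lemma beginRound_count (σ : ArgmaxRule K) (α ε : ℝ) (n : ℕ) (s : State K) :
    (beginRound σ α ε n s).count = s.count := by
  unfold beginRound; split_ifs <;> rfl

lemma beginRound_privMean (σ : ArgmaxRule K) (α ε : ℝ) (n : ℕ) (s : State K) :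
    (beginRound σ α ε n s).privMean = s.privMean := by
  unfold beginRound; split_ifs <;> rfl

lemma endRound_count_apply (s : State K) (r z : ℝ) (a : Fin K) :
    (endRound s r z).count a = s.count a + if a = s.arm then 1 else 0 := by
  by_cases h : a = s.arm
  · subst h; simp [endRound]
  · simp [endRound, h]

lemma measurable_snoc {β : Type*} [MeasurableSpace β] {n : ℕ} :
    Measurable fun p : (Fin n → β) × β => (Fin.snoc p.1 p.2 : Fin (n + 1) → β) := by
  refine measurable_pi_iff.2 (Fin.lastCases ?_ fun i => ?_)
  · simpa using measurable_snd
  · simp only [Fin.snoc_castSucc]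
    fun_prop

lemma measurable_init {β : Type*} [MeasurableSpace β] {n : ℕ} :
    Measurable fun h : Fin (n + 1) → β => (Fin.init h : Fin n → β) :=
  measurable_pi_iff.2 fun i => measurable_pi_apply i.castSucc

/-- The additive functional of the history that collects `f i` before each round `i + 1`. -/
def historySum (f : ∀ n, (Fin n → Round K) → ℝ) : ∀ n, (Fin n → Round K) → ℝ
  | 0, _ => 0
  | n + 1, h => historySum f n (Fin.init h) + f n (Fin.init h)

lemma historySum_nonneg {f : ∀ n, (Fin n → Round K) → ℝ} (hf : ∀ n h, 0 ≤ f n h) (n : ℕ)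
    (h : Fin n → Round K) : 0 ≤ historySum f n h := by
  induction n with
  | zero => exact le_rfl
  | succ n ih => exact add_nonneg (ih _) (hf n _)

section Law

variable [NeZero K]

/-- The state in which round `n + 1` is played, after the `n` rounds recorded in `h`: it differs
from `state` only when a new episode starts. -/
def roundState (σ : ArgmaxRule K) (α ε : ℝ) (n : ℕ) (h : Fin n → Round K) : State K :=
  beginRound σ α ε n (state σ α ε n h)

variable {σ : ArgmaxRule K} {α ε : ℝ} {ν : Fin K → Measure ℝ}

lemma state_snoc {n : ℕ} (h : Fin n → Round K) (r : Round K) :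
    state σ α ε (n + 1) (Fin.snoc h r) = endRound (roundState σ α ε n h) r.2.1 r.2.2 := by
  simp [state, roundState]

lemma state_succ {n : ℕ} (h : Fin (n + 1) → Round K) :
    state σ α ε (n + 1) h =
      endRound (roundState σ α ε n (Fin.init h)) (h (Fin.last n)).2.1 (h (Fin.last n)).2.2 :=
  rfl

lemma roundState_count {n : ℕ} (h : Fin n → Round K) :
    (roundState σ α ε n h).count = (state σ α ε n h).count :=
  beginRound_count ..

lemma measurable_nextArm (n : ℕ) : Measurable (nextArm σ α ε n) :=
  (measurable_next σ α ε n).fst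

lemma sum_mul_count_succ {R : Type*} [Semiring R] (w : Fin K → R) {n : ℕ}
    (h : Fin (n + 1) → Round K) :
    ∑ a, w a * (state σ α ε (n + 1) h).count a =
      ∑ a, w a * (state σ α ε n (Fin.init h)).count a + w (nextArm σ α ε n (Fin.init h)) := by
  simp only [state_succ, endRound_count_apply, roundState_count, Nat.cast_add, mul_add,
    Finset.sum_add_distrib, Nat.cast_ite, Nat.cast_one, Nat.cast_zero, mul_ite, mul_one, mul_zero,
    Finset.sum_ite_eq', Finset.mem_univ, if_true]
  rfl

theorem sum_count_state {n : ℕ} (h : Fin n → Round K) : ∑ a, (state σ α ε n h).count a = n := by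
  induction n with
  | zero => simp [state, initState]
  | succ n ih => simpa [ih] using sum_mul_count_succ (σ := σ) (α := α) (ε := ε) (1 : Fin K → ℕ) h

lemma count_state_le {n : ℕ} (h : Fin n → Round K) (a : Fin K) :
    (state σ α ε n h).count a ≤ n := by
  conv_rhs => rw [← sum_count_state (σ := σ) (α := α) (ε := ε) h]
  exact Finset.single_le_sum (fun _ _ => Nat.zero_le _) (Finset.mem_univ a)

variable [∀ a, IsProbabilityMeasure (ν a)]

lemma stepKernel_apply (n : ℕ) (h : Fin n → Round K) :
    stepKernel σ α ε ν n h =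
      (rewardNoise ν ε (roundState σ α ε n h)).map (Prod.mk (nextArm σ α ε n h)) := by
  rw [← Measure.dirac_prod, rewardNoise, roundState_count]
  rfl

lemma lintegral_law_succ {n : ℕ} {F : (Fin (n + 1) → Round K) → ENNReal} (hF : Measurable F) :
    ∫⁻ h, F h ∂(law σ α ε ν (n + 1)) =
      ∫⁻ h, ∫⁻ p, F (Fin.snoc h (nextArm σ α ε n h, p))
        ∂(rewardNoise ν ε (roundState σ α ε n h)) ∂(law σ α ε ν n) := by
  rw [law, lintegral_map hF measurable_snoc]
  refine (Measure.lintegral_compProd (hF.comp measurable_snoc)).trans ?_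
  simp only [stepKernel_apply]
  exact lintegral_congr fun h =>
    lintegral_map (hF.comp (measurable_snoc.comp measurable_prodMk_left)) measurable_prodMk_left

theorem lintegral_state_le {F : State K → ENNReal}
    (hF : ∀ n, Measurable fun h => F (state σ α ε n h))
    (hstep : ∀ n h, ∫⁻ p, F (endRound (roundState σ α ε n h) p.1 p.2)
      ∂(rewardNoise ν ε (roundState σ α ε n h)) ≤ F (state σ α ε n h)) (n : ℕ) :
    ∫⁻ h, F (state σ α ε n h) ∂(law σ α ε ν n) ≤ F (initState K) := by
  induction n with
  | zero => simp [state]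
  | succ n ih =>
    rw [lintegral_law_succ (hF (n + 1))]
    simp only [state_snoc]
    exact (lintegral_mono fun h => hstep n h).trans ih

lemma measurePreserving_init (n : ℕ) :
    MeasurePreserving (Fin.init : (Fin (n + 1) → Round K) → Fin n → Round K)
      (law σ α ε ν (n + 1)) (law σ α ε ν n) where
  measurable := measurable_init
  map_eq := by
    rw [law, Measure.map_map measurable_init measurable_snoc]
    have init_snoc : (Fin.init ∘ fun p : (Fin n → Round K) × Round K =>
        (Fin.snoc p.1 p.2 : Fin (n + 1) → Round K)) = Prod.fst :=
      funext fun p => Fin.init_snoc (α := fun _ => Round K) p.2 p.1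
    rw [init_snoc]
    exact Measure.fst_compProd _ _

lemma integral_comp_init {n : ℕ} {f : (Fin n → Round K) → ℝ}
    (hf : AEStronglyMeasurable f (law σ α ε ν n)) :
    ∫ h, f (Fin.init h) ∂(law σ α ε ν (n + 1)) = ∫ h, f h ∂(law σ α ε ν n) := by
  have hinit := measurePreserving_init (σ := σ) (α := α) (ε := ε) (ν := ν) n
  rw [← hinit.map_eq] at hf ⊢
  exact (integral_map hinit.measurable.aemeasurable hf).symm

lemma integrable_mean_nextArm (n : ℕ) :
    Integrable (fun h => mean ν (nextArm σ α ε n h)) (law σ α ε ν n) :=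
  (Integrable.of_finite (f := mean ν)).comp_measurable (measurable_nextArm n)

lemma ae_law_last_reward_mem (hν : ∀ a, ∀ᵐ x ∂(ν a), x ∈ Set.Icc (0 : ℝ) 1) (n : ℕ) :
    ∀ᵐ h ∂(law σ α ε ν (n + 1)), (h (Fin.last n)).2.1 ∈ Set.Icc (0 : ℝ) 1 := by
  have hset : MeasurableSet {h : Fin (n + 1) → Round K |
      (h (Fin.last n)).2.1 ∈ Set.Icc (0 : ℝ) 1} :=
    measurableSet_Icc.preimage (by fun_prop)
  rw [law, ae_map_iff measurable_snoc.aemeasurable hset]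
  refine Measure.ae_compProd_of_ae_ae (measurable_snoc hset) (.of_forall fun h => ?_)
  rw [stepKernel_apply]
  refine (ae_map_iff measurable_prodMk_left.aemeasurable
    ((measurable_snoc.comp measurable_prodMk_left) hset)).2 ?_
  filter_upwards [ae_fst_mem_rewardNoise (ε := ε) (hν (roundState σ α ε n h).arm)] with p hp
  simpa using hp

theorem ae_law_reward_mem (hν : ∀ a, ∀ᵐ x ∂(ν a), x ∈ Set.Icc (0 : ℝ) 1) (n : ℕ) :
    ∀ᵐ h ∂(law σ α ε ν n), ∀ t, (h t).2.1 ∈ Set.Icc (0 : ℝ) 1 := by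
  induction n with
  | zero => exact .of_forall fun h t => t.elim0
  | succ n ih =>
    filter_upwards [(measurePreserving_init n).quasiMeasurePreserving.ae ih,
      ae_law_last_reward_mem hν n] with h hinit hlast
    exact Fin.forall_fin_succ'.2 ⟨hinit, hlast⟩

lemma integrable_reward (hν : ∀ a, ∀ᵐ x ∂(ν a), x ∈ Set.Icc (0 : ℝ) 1) {n : ℕ} (t : Fin n) :
    Integrable (fun h : Fin n → Round K => (h t).2.1) (law σ α ε ν n) := by
  have hmeas : Measurable fun h : Fin n → Round K => (h t).2.1 := by fun_prop
  refine .of_mem_Icc 0 1 hmeas.aemeasurable ?_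
  filter_upwards [ae_law_reward_mem hν n] with h hh using hh t

lemma integrable_sum_mul_count (w : Fin K → ℝ) (n : ℕ) :
    Integrable (fun h => ∑ a, w a * (state σ α ε n h).count a) (law σ α ε ν n) := by
  refine integrable_finsetSum _ fun a _ => Integrable.const_mul ?_ _
  have hmeas : Measurable fun h => ((state σ α ε n h).count a : ℝ) :=
    measurable_from_nat.comp ((measurable_pi_apply a).comp (measState_state σ α ε n).count)
  exact .of_mem_Icc 0 n hmeas.aemeasurable <| .of_forall fun h =>
    ⟨Nat.cast_nonneg _, mod_cast count_state_le h a⟩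

lemma integral_last_reward (hν : ∀ a, ∀ᵐ x ∂(ν a), x ∈ Set.Icc (0 : ℝ) 1) (n : ℕ) :
    ∫ h, (h (Fin.last n)).2.1 ∂(law σ α ε ν (n + 1)) =
      ∫ h, mean ν (nextArm σ α ε n h) ∂(law σ α ε ν n) := by
  have hint := integrable_reward (σ := σ) (α := α) (ε := ε) hν (Fin.last n)
  rw [law] at hint ⊢
  rw [integral_map measurable_snoc.aemeasurable hint.aestronglyMeasurable]
  rw [integrable_map_measure hint.aestronglyMeasurable measurable_snoc.aemeasurable] at hint
  refine (Measure.integral_compProd hint).trans (integral_congr_ae (.of_forall fun h => ?_))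
  simp only [Function.comp_apply, Fin.snoc_last]
  rw [stepKernel_apply, integral_map measurable_prodMk_left.aemeasurable (by fun_prop)]
  exact integral_fst_rewardNoise

theorem integral_sum_reward (hν : ∀ a, ∀ᵐ x ∂(ν a), x ∈ Set.Icc (0 : ℝ) 1) (n : ℕ) :
    ∫ h, ∑ t, (h t).2.1 ∂(law σ α ε ν n) =
      ∫ h, ∑ a, mean ν a * (state σ α ε n h).count a ∂(law σ α ε ν n) := by
  induction n with
  | zero => simp [state, initState]
  | succ n ih =>
    have hsum : Integrable (fun h : Fin n → Round K => ∑ t, (h t).2.1) (law σ α ε ν n) :=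
      integrable_finsetSum _ fun t _ => integrable_reward hν t
    have hsum_init : Integrable (fun h : Fin (n + 1) → Round K => ∑ t, (Fin.init h t).2.1)
        (law σ α ε ν (n + 1)) := (measurePreserving_init n).integrable_comp_of_integrable hsum
    have hcount := integrable_sum_mul_count (σ := σ) (α := α) (ε := ε) (ν := ν) (mean ν) n
    have hmean := integrable_mean_nextArm (σ := σ) (α := α) (ε := ε) (ν := ν) n
    calc ∫ h, ∑ t, (h t).2.1 ∂(law σ α ε ν (n + 1))
        = ∫ h, (∑ t, (Fin.init h t).2.1 + (h (Fin.last n)).2.1) ∂(law σ α ε ν (n + 1)) := by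
          simp only [Fin.sum_univ_castSucc, Fin.init]
      _ = ∫ h, ∑ t, (h t).2.1 ∂(law σ α ε ν n) +
            ∫ h, mean ν (nextArm σ α ε n h) ∂(law σ α ε ν n) := by
          rw [integral_add hsum_init (integrable_reward hν _)]
          exact congrArg₂ _ (integral_comp_init hsum.aestronglyMeasurable)
            (integral_last_reward hν n)
      _ = ∫ h, (∑ a, mean ν a * (state σ α ε n h).count a + mean ν (nextArm σ α ε n h))
            ∂(law σ α ε ν n) := by
          rw [ih, integral_add hcount hmean]
      _ = ∫ h, ∑ a, mean ν a * (state σ α ε (n + 1) h).count a ∂(law σ α ε ν (n + 1)) := by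
          simp only [sum_mul_count_succ]
          exact (integral_comp_init (hcount.add hmean).aestronglyMeasurable).symm

lemma integrable_historySum {f : ∀ n, (Fin n → Round K) → ℝ}
    (hf : ∀ n, Integrable (f n) (law σ α ε ν n)) (n : ℕ) :
    Integrable (historySum f n) (law σ α ε ν n) := by
  induction n with
  | zero => exact integrable_zero ..
  | succ n ih => exact (measurePreserving_init n).integrable_comp_of_integrable (ih.add (hf n))

theorem integral_historySum {f : ∀ n, (Fin n → Round K) → ℝ}
    (hf : ∀ n, Integrable (f n) (law σ α ε ν n)) (n : ℕ) :
    ∫ h, historySum f n h ∂(law σ α ε ν n) =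
      ∑ i ∈ Finset.range n, ∫ h, f i h ∂(law σ α ε ν i) := by
  induction n with
  | zero => simp [historySum]
  | succ n ih =>
    rw [Finset.sum_range_succ, ← ih, ← integral_add (integrable_historySum hf n) (hf n)]
    exact integral_comp_init ((integrable_historySum hf n).add (hf n)).aestronglyMeasurable

end Law

/-! ### Episodes and dyadic blocks of plays -/

/-- Numbering its plays from `0`, the plays of an arm are divided into the blocks
`[0, 1), [1, 2), [2, 4), [4, 8), …`, one for each episode. `blockStart c` is the first play of the
block of play number `c`. -/
def blockStart (c : ℕ) : ℕ := 2 ^ c.size / 2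

/-- The end, not included, of the block of play number `c`; see `blockStart`. -/
def blockEnd (c : ℕ) : ℕ := 2 ^ c.size

/-- Play number `c` is the first one of its block; see `blockStart`. -/
def IsBlockStart (c : ℕ) : Prop := blockStart c = c

lemma lt_blockEnd (c : ℕ) : c < blockEnd c := Nat.lt_size_self c

lemma size_eq_of_mem_block {c j : ℕ} (hstart : 2 ^ j / 2 ≤ c) (hend : c < 2 ^ j) : c.size = j := by
  refine le_antisymm (Nat.size_le.2 hend) ?_
  rcases j with - | i
  · exact Nat.zero_le _
  · rw [pow_succ, Nat.mul_div_cancel _ two_pos] at hstart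
    exact Nat.lt_size.2 hstart

lemma blockStart_le (c : ℕ) : blockStart c ≤ c := by
  unfold blockStart
  rcases h : c.size with - | i
  · exact Nat.zero_le _
  · rw [pow_succ, Nat.mul_div_cancel _ two_pos]
    exact Nat.lt_size.1 (by lia)

lemma size_succ_of_lt_blockEnd {c : ℕ} (h : c + 1 < blockEnd c) : (c + 1).size = c.size :=
  size_eq_of_mem_block ((blockStart_le c).trans c.le_succ) h

lemma isBlockStart_zero : IsBlockStart 0 := rfl

lemma isBlockStart_two_pow (i : ℕ) : IsBlockStart (2 ^ i) := by
  rw [IsBlockStart, blockStart, Nat.size_pow, pow_succ, Nat.mul_div_cancel _ two_pos]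

lemma isBlockStart_two_pow_div_two (j : ℕ) : IsBlockStart (2 ^ j / 2) := by
  rcases j with - | i
  · exact isBlockStart_zero
  · rw [pow_succ, Nat.mul_div_cancel _ two_pos]
    exact isBlockStart_two_pow i

lemma IsBlockStart.two_mul_eq {c : ℕ} (h : IsBlockStart c) (hc : 0 < c) : 2 * c = blockEnd c := by
  obtain ⟨i, hi⟩ := Nat.exists_eq_add_of_lt (Nat.size_pos.2 hc)
  nth_rw 1 [← h]
  rw [blockStart, blockEnd, hi, pow_succ, Nat.mul_div_cancel _ two_pos, mul_comm]

lemma IsBlockStart.exists_eq_two_pow {c : ℕ} (h : IsBlockStart c) (hc : 0 < c) :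
    ∃ i, c = 2 ^ i := by
  have htwo := h.two_mul_eq hc
  obtain ⟨i, hi⟩ := Nat.exists_eq_add_of_lt (Nat.size_pos.2 hc)
  rw [blockEnd, hi, zero_add, pow_succ, mul_comm] at htwo
  exact ⟨i, Nat.eq_of_mul_eq_mul_right two_pos htwo⟩

lemma not_isBlockStart {c j : ℕ} (hstart : 2 ^ j / 2 < c) (hend : c < 2 ^ j) :
    ¬ IsBlockStart c := by
  rw [IsBlockStart, blockStart, size_eq_of_mem_block hstart.le hend]
  exact hstart.ne

/-- The properties that the state after `n` rounds always has: every arm other than the current one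
has just completed a block, and the last play of the current arm, if any, is in the block that the
current episode plays. -/
structure Reachable (n : ℕ) (s : State K) : Prop where
  count_of_le : n ≤ K → ∀ a : Fin K, s.count a = if (a : ℕ) < n then 1 else 0
  one_le_count : K ≤ n → ∀ a, 1 ≤ s.count a
  isBlockStart : ∀ a, a ≠ s.arm → IsBlockStart (s.count a)
  episode : n ≠ 0 → ∃ c, s.count s.arm = c + 1 ∧ s.goal = blockEnd c ∧ s.start = blockStart c

/-- The properties that the state in which a round is played always has: the next play of the
current arm is in the block that the current episode plays, and the other arms have just completed
a block. -/
structure Ready (s : State K) : Prop where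
  isBlockStart : ∀ a, a ≠ s.arm → IsBlockStart (s.count a)
  goal_eq : s.goal = blockEnd (s.count s.arm)
  start_eq : s.start = blockStart (s.count s.arm)
  rewardSum_eq : IsBlockStart (s.count s.arm) → s.rewardSum = 0

namespace Reachable

variable {n : ℕ} {s : State K}

lemma isBlockStart_of_goal_le (hs : Reachable n s) (hn : n ≠ 0) (hgoal : s.goal ≤ s.count s.arm)
    (a : Fin K) : IsBlockStart (s.count a) := by
  by_cases ha : a = s.arm
  · obtain ⟨c, hcount, hblock, -⟩ := hs.episode hn
    have hend : c + 1 = 2 ^ c.size := by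
      have := lt_blockEnd c
      unfold blockEnd at *
      lia
    rw [ha, hcount, hend]
    exact isBlockStart_two_pow _
  · exact hs.isBlockStart a ha

lemma isBlockStart_of_le (hs : Reachable n s) (hn : n ≤ K) (a : Fin K) :
    IsBlockStart (s.count a) := by
  rw [hs.count_of_le hn]
  split_ifs
  · exact isBlockStart_two_pow 0
  · exact isBlockStart_zero

lemma ready [NeZero K] (hs : Reachable n s) (σ : ArgmaxRule K) (α ε : ℝ) :
    Ready (beginRound σ α ε n s) := by
  by_cases hK : n < K
  · have hzero : s.count ⟨n, hK⟩ = 0 := by rw [hs.count_of_le hK.le, if_neg (lt_irrefl n)]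
    simp only [beginRound, hK, dite_true]
    exact ⟨fun a _ => hs.isBlockStart_of_le hK.le a, by simp [hzero, blockEnd],
      by simp [hzero, blockStart], fun _ => rfl⟩
  have hn : n ≠ 0 := by have := NeZero.ne K; lia
  by_cases hgoal : s.count s.arm < s.goal
  · simp only [beginRound, hK, dite_false, hgoal, if_true]
    obtain ⟨c, hcount, hblock, hstart⟩ := hs.episode hn
    have hsize : (s.count s.arm).size = c.size := by
      rw [hcount, size_succ_of_lt_blockEnd (by lia)]
    refine ⟨hs.isBlockStart, by rw [hblock, blockEnd, blockEnd, hsize],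
      by rw [hstart, blockStart, blockStart, hsize], fun hfirst => ?_⟩
    rw [IsBlockStart, blockStart, hsize] at hfirst
    have hle : 2 ^ c.size / 2 ≤ c := blockStart_le c
    lia
  · simp only [beginRound, hK, dite_false, hgoal, if_false]
    have hfirst := hs.isBlockStart_of_goal_le hn (not_lt.1 hgoal)
    exact ⟨fun a _ => hfirst a, (hfirst _).two_mul_eq (hs.one_le_count (not_lt.1 hK) _),
      (hfirst _).symm, fun _ => rfl⟩

lemma beginRound_eq_self [NeZero K] (hs : Reachable n s) (σ : ArgmaxRule K) (α ε : ℝ) {a : Fin K}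
    (ha : ¬ IsBlockStart (s.count a)) : beginRound σ α ε n s = s := by
  have hK : ¬ n < K := fun hK => ha (hs.isBlockStart_of_le hK.le a)
  have hn : n ≠ 0 := by have := NeZero.ne K; lia
  have hgoal : s.count s.arm < s.goal :=
    not_le.1 fun hle => ha (hs.isBlockStart_of_goal_le hn hle a)
  simp [beginRound, hK, hgoal]

end Reachable

theorem reachable_state [NeZero K] (σ : ArgmaxRule K) (α ε : ℝ) (n : ℕ) (h : Fin n → Round K) :
    Reachable n (state σ α ε n h) := by
  induction n with
  | zero =>
    exact ⟨fun _ _ => rfl, fun hK => absurd (Nat.le_zero.1 hK) (NeZero.ne K),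
      fun _ _ => isBlockStart_zero, fun h => absurd rfl h⟩
  | succ n ih =>
    specialize ih (Fin.init h)
    have hready := ih.ready σ α ε
    have hcount : n + 1 ≤ K → ∀ a : Fin K,
        (state σ α ε (n + 1) h).count a = if (a : ℕ) < n + 1 then 1 else 0 := by
      intro hn a
      rw [state_succ, endRound_count_apply, roundState_count, ih.count_of_le (by lia) a, roundState]
      simp only [beginRound, show n < K from hn, dite_true, Fin.ext_iff]
      split_ifs <;> lia
    refine ⟨hcount, fun hK a => ?_, fun a ha => ?_, fun _ => ⟨_, ?_, hready.goal_eq,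
      hready.start_eq⟩⟩
    · rcases hK.lt_or_eq with hlt | heq
      · have := ih.one_le_count (Nat.lt_succ_iff.1 hlt) a
        rw [state_succ, endRound_count_apply, roundState_count]
        lia
      · rw [hcount heq.ge a, if_pos (by rw [← heq]; exact a.2)]
    · rw [state_succ, endRound_count_apply]
      rw [if_neg (show a ≠ (roundState σ α ε n (Fin.init h)).arm from ha), add_zero]
      exact hready.isBlockStart a ha
    · rw [state_succ, endRound_count_apply]
      exact congrArg _ (if_pos rfl)

/-! ### Concentration of the private means -/

/-- The sum of the rewards of arm `a` collected so far in the block of its plays that ends with the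
`2 ^ j`-th one, or `0` if no play of this block has taken place. It has this meaning only until the
block is completed. -/
def blockSum (a : Fin K) (j : ℕ) (s : State K) : ℝ :=
  if s.count a ≤ 2 ^ j / 2 then 0 else s.rewardSum

/-- The Chernoff bound, given the rewards already collected, for the probability that the average
reward over the block of plays of arm `a` that ends with the `2 ^ j`-th one deviates from `μ` by
more than `x` in the direction `κ = ±1`. The truncated subtraction `s.count a - 2 ^ j / 2` is the
number of plays of the block that have taken place. -/
def chernoffBound (a : Fin K) (j : ℕ) (μ κ x : ℝ) (s : State K) : ENNReal :=
  ENNReal.ofReal (Real.exp (4 * κ * x * (blockSum a j s - (s.count a - 2 ^ j / 2 : ℕ) * μ)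
    - 2 * ((2 ^ j - 2 ^ j / 2 : ℕ) + (s.count a - 2 ^ j / 2 : ℕ)) * x ^ 2))

/-- Arm `a` has been played `N` times, and its private mean deviates from `μ` by more than `ρ` in
the direction `κ = ±1`. -/
def Deviates (a : Fin K) (N : ℕ) (μ κ ρ : ℝ) (s : State K) : Prop :=
  s.count a = N ∧ ρ < κ * (s.privMean a - μ)

open Classical in
/-- A supermartingale along the rounds that ends, once arm `a` has been played `2 ^ j` times, with
the indicator of a deviation `x + y` of the private mean: until then it adds to `chernoffBound` the
tail probability of the Laplace noise at `y`. -/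
def deviationPotential (a : Fin K) (j : ℕ) (μ κ x y ε : ℝ) (s : State K) : ENNReal :=
  if s.count a < 2 ^ j then
    chernoffBound a j μ κ x s + ENNReal.ofReal (Real.exp (-(ε * (2 ^ j : ℕ) * y / 2)))
  else if Deviates a (2 ^ j) μ κ (x + y) s then 1 else 0

section Measurability

variable {Ω : Type*} [MeasurableSpace Ω] {f : Ω → State K}

lemma MeasState.measurable_count_apply (hf : MeasState f) (a : Fin K) :
    Measurable fun ω => (f ω).count a :=
  (measurable_pi_apply a).comp hf.count

lemma MeasState.measurableSet_deviates (hf : MeasState f) (a : Fin K) (N : ℕ) (μ κ ρ : ℝ) :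
    MeasurableSet {ω | Deviates a N μ κ ρ (f ω)} := by
  have hmean : Measurable fun ω => (f ω).privMean a := (measurable_pi_apply a).comp hf.privMean
  exact (measurableSet_eq_fun (hf.measurable_count_apply a) measurable_const).inter
    (measurableSet_lt measurable_const ((hmean.sub_const μ).const_mul κ))

lemma MeasState.measurable_chernoffBound (hf : MeasState f) (a : Fin K) (j : ℕ) (μ κ x : ℝ) :
    Measurable fun ω => chernoffBound a j μ κ x (f ω) := by
  have hcount := hf.measurable_count_apply a
  have hplays : Measurable fun ω => (((f ω).count a - 2 ^ j / 2 : ℕ) : ℝ) :=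
    (measurable_from_nat (f := fun c => ((c - 2 ^ j / 2 : ℕ) : ℝ))).comp hcount
  have hsum : Measurable fun ω => blockSum a j (f ω) :=
    Measurable.ite (measurableSet_le hcount measurable_const) measurable_const hf.rewardSum
  unfold chernoffBound
  fun_prop

lemma MeasState.measurable_deviationPotential (hf : MeasState f) (a : Fin K) (j : ℕ)
    (μ κ x y ε : ℝ) : Measurable fun ω => deviationPotential a j μ κ x y ε (f ω) :=
  Measurable.ite (measurableSet_lt (hf.measurable_count_apply a) measurable_const)
    ((hf.measurable_chernoffBound a j μ κ x).add_const _)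
    (Measurable.ite (hf.measurableSet_deviates ..) measurable_const measurable_const)

end Measurability

section Potential

variable {a : Fin K} {j : ℕ} {μ κ x y ε : ℝ} {s s' : State K}

lemma blockSum_eq_zero (hfirst : IsBlockStart (s.count a)) (hlt : s.count a < 2 ^ j) :
    blockSum a j s = 0 :=
  if_pos (not_lt.1 fun hstart => not_isBlockStart hstart hlt hfirst)

lemma deviationPotential_congr (hcount : s.count a = s'.count a)
    (hmean : s.privMean a = s'.privMean a)
    (hsum : s.count a < 2 ^ j → blockSum a j s = blockSum a j s') :
    deviationPotential a j μ κ x y ε s = deviationPotential a j μ κ x y ε s' := by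
  unfold deviationPotential Deviates chernoffBound
  rw [← hcount, ← hmean]
  split_ifs with hlt
  · rw [hsum hlt]
  all_goals rfl

lemma deviationPotential_beginRound [NeZero K] {n : ℕ} (hs : Reachable n s) (σ : ArgmaxRule K)
    (α : ℝ) :
    deviationPotential a j μ κ x y ε (beginRound σ α ε n s) =
      deviationPotential a j μ κ x y ε s := by
  by_cases hfirst : IsBlockStart (s.count a)
  · have hcount : (beginRound σ α ε n s).count a = s.count a := by rw [beginRound_count]
    refine deviationPotential_congr hcount (by rw [beginRound_privMean]) fun hlt => ?_
    rw [hcount] at hlt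
    rw [blockSum_eq_zero hfirst hlt, blockSum_eq_zero (by rwa [hcount]) (by rwa [hcount])]
  · rw [hs.beginRound_eq_self σ α ε hfirst]

lemma deviationPotential_endRound_of_ne (hs : Ready s) (ha : a ≠ s.arm) (r z : ℝ) :
    deviationPotential a j μ κ x y ε (endRound s r z) = deviationPotential a j μ κ x y ε s := by
  have hcount : (endRound s r z).count a = s.count a := by
    rw [endRound_count_apply, if_neg ha, add_zero]
  refine deviationPotential_congr hcount ?_ fun hlt => ?_
  · simp only [endRound]
    split_ifs
    · exact Function.update_of_ne ha _ _
    · rfl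
  · have hfirst := hs.isBlockStart a ha
    rw [hcount] at hlt
    rw [blockSum_eq_zero hfirst hlt, blockSum_eq_zero (by rwa [hcount]) (by rwa [hcount])]

lemma endRound_count_arm (s : State K) (r z : ℝ) :
    (endRound s r z).count s.arm = s.count s.arm + 1 := by
  rw [endRound_count_apply, if_pos rfl]

lemma blockSum_endRound (hs : Ready s) (hle : 2 ^ j / 2 ≤ s.count s.arm) (r z : ℝ) :
    blockSum s.arm j (endRound s r z) = blockSum s.arm j s + r := by
  have hnext : ¬ s.count s.arm + 1 ≤ 2 ^ j / 2 := by lia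
  rw [blockSum, endRound_count_arm, if_neg hnext, blockSum]
  split_ifs with hge
  · have hfirst : IsBlockStart (s.count s.arm) := by
      rw [le_antisymm hge hle]
      exact isBlockStart_two_pow_div_two j
    rw [← hs.rewardSum_eq hfirst]
    rfl
  · rfl

lemma privMean_endRound (hs : Ready s) (hcount : s.count s.arm + 1 = 2 ^ j) (r z : ℝ) :
    (endRound s r z).privMean s.arm =
      blockSum s.arm j (endRound s r z) / (2 ^ j - 2 ^ j / 2 : ℕ) + z := by
  have hsize : (s.count s.arm).size = j := size_eq_of_mem_block (by lia) (by lia)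
  have hgoal : s.goal = 2 ^ j := by rw [hs.goal_eq, blockEnd, hsize]
  have hstart : s.start = 2 ^ j / 2 := by rw [hs.start_eq, blockStart, hsize]
  have hnext : ¬ s.count s.arm + 1 ≤ 2 ^ j / 2 := by lia
  rw [blockSum, endRound_count_arm, if_neg hnext, Nat.cast_sub (Nat.div_le_self ..)]
  simp only [endRound, hgoal, hstart, hcount, if_true, Function.update_self]

lemma one_le_chernoffBound (hcount : s.count a = 2 ^ j) (hx : 0 ≤ x)
    (hdev : x < κ * (blockSum a j s / (2 ^ j - 2 ^ j / 2 : ℕ) - μ)) :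
    1 ≤ chernoffBound a j μ κ x s := by
  rw [chernoffBound, hcount, ENNReal.one_le_ofReal, Real.one_le_exp_iff]
  have hm : (0 : ℝ) < (2 ^ j - 2 ^ j / 2 : ℕ) := by
    have := Nat.one_le_two_pow (n := j)
    exact_mod_cast (by lia : 0 < 2 ^ j - 2 ^ j / 2)
  set m : ℝ := ((2 ^ j - 2 ^ j / 2 : ℕ) : ℝ)
  calc 0 ≤ 4 * m * x * (κ * (blockSum a j s / m - μ) - x) := by
        have := sub_nonneg.2 hdev.le
        positivity
    _ = 4 * κ * x * (blockSum a j s - m * μ) - 2 * (m + m) * x ^ 2 := by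
        field_simp
        ring

lemma Deviates.one_le_chernoffBound_or_lt (hs : Ready s) (hcount : s.count s.arm + 1 = 2 ^ j)
    (hx : 0 ≤ x) {r z : ℝ} (hdev : Deviates s.arm (2 ^ j) μ κ (x + y) (endRound s r z)) :
    1 ≤ chernoffBound s.arm j μ κ x (endRound s r z) ∨ y < κ * z := by
  have hlt := hdev.2
  rw [privMean_endRound hs hcount] at hlt
  refine or_iff_not_imp_right.2 fun hz => one_le_chernoffBound hdev.1 hx ?_
  linarith

variable {ν : Fin K → Measure ℝ} [∀ a, IsProbabilityMeasure (ν a)]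

lemma lintegral_chernoffBound_endRound_le (hs : Ready s)
    (hν : ∀ᵐ r ∂(ν s.arm), r ∈ Set.Icc (0 : ℝ) 1) (hκ : |κ| = 1) (x : ℝ) (j : ℕ) :
    ∫⁻ p, chernoffBound s.arm j (mean ν s.arm) κ x (endRound s p.1 p.2) ∂(rewardNoise ν ε s) ≤
      chernoffBound s.arm j (mean ν s.arm) κ x s := by
  by_cases hle : 2 ^ j / 2 ≤ s.count s.arm
  · have hκsq : κ ^ 2 = 1 := by rw [← sq_abs, hκ, one_pow]
    have hplays : s.count s.arm + 1 - 2 ^ j / 2 = s.count s.arm - 2 ^ j / 2 + 1 := by lia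
    simp only [chernoffBound, endRound_count_arm, blockSum_endRound hs hle, hplays,
      Nat.cast_add_one]
    set m : ℝ := ((2 ^ j - 2 ^ j / 2 : ℕ) : ℝ)
    set i : ℝ := ((s.count s.arm - 2 ^ j / 2 : ℕ) : ℝ)
    set S := blockSum s.arm j s
    have hoeffding := lintegral_exp_add_mul_le (hasSubgaussianMGF_reward (ε := ε) hν)
      (4 * κ * x * (S - i * mean ν s.arm) - 2 * (m + i + 1) * x ^ 2) (4 * κ * x)
    convert hoeffding using 2
    · funext p
      congr 2
      ring
    · congr 2
      push_cast
      linear_combination (-2) * x ^ 2 * hκsq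
  · have hplays : s.count s.arm + 1 - 2 ^ j / 2 = s.count s.arm - 2 ^ j / 2 := by lia
    have hnext : s.count s.arm + 1 ≤ 2 ^ j / 2 := by lia
    simp only [chernoffBound, blockSum, endRound_count_arm, if_pos hnext,
      if_pos (not_le.1 hle).le, hplays, lintegral_const, measure_univ, mul_one, le_refl]

lemma lintegral_deviationPotential_endRound_of_last_play_le (hs : Ready s)
    (hν : ∀ᵐ r ∂(ν s.arm), r ∈ Set.Icc (0 : ℝ) 1) (hε : 0 < ε) (hκ : |κ| = 1) (hx : 0 ≤ x)
    (hy : 0 ≤ y) (hlast : s.count s.arm + 1 = 2 ^ j) :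
    ∫⁻ p, deviationPotential s.arm j (mean ν s.arm) κ x y ε (endRound s p.1 p.2)
      ∂(rewardNoise ν ε s) ≤ deviationPotential s.arm j (mean ν s.arm) κ x y ε s := by
  have hnoise : MeasurableSet {p : ℝ × ℝ | y < κ * p.2} :=
    measurableSet_lt measurable_const (by fun_prop)
  have hle : ∀ p : ℝ × ℝ,
      deviationPotential s.arm j (mean ν s.arm) κ x y ε (endRound s p.1 p.2) ≤
        chernoffBound s.arm j (mean ν s.arm) κ x (endRound s p.1 p.2) +
          {p : ℝ × ℝ | y < κ * p.2}.indicator 1 p := by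
    intro p
    rw [deviationPotential, if_neg (by rw [endRound_count_arm]; lia)]
    split_ifs with hdev
    · rcases hdev.one_le_chernoffBound_or_lt hs hlast hx with hchernoff | hz
      · exact le_add_right hchernoff
      · rw [Set.indicator_of_mem (by exact hz)]
        exact le_add_self
    · exact zero_le
  refine (lintegral_mono hle).trans ?_
  rw [lintegral_add_right _ (measurable_one.indicator hnoise), lintegral_indicator_one hnoise,
    deviationPotential, if_pos (by lia)]
  exact add_le_add (lintegral_chernoffBound_endRound_le hs hν hκ x j)
    (hlast ▸ rewardNoise_noise_tail_le hε hκ hy)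

theorem lintegral_deviationPotential_endRound_le (hs : Ready s)
    (hν : ∀ᵐ r ∂(ν s.arm), r ∈ Set.Icc (0 : ℝ) 1) (hε : 0 < ε) (hκ : |κ| = 1) (hx : 0 ≤ x)
    (hy : 0 ≤ y) (a : Fin K) (j : ℕ) :
    ∫⁻ p, deviationPotential a j (mean ν a) κ x y ε (endRound s p.1 p.2) ∂(rewardNoise ν ε s) ≤
      deviationPotential a j (mean ν a) κ x y ε s := by
  by_cases ha : a = s.arm
  swap
  · simp only [deviationPotential_endRound_of_ne hs ha, lintegral_const, measure_univ, mul_one,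
      le_refl]
  subst ha
  rcases lt_trichotomy (s.count s.arm + 1) (2 ^ j) with hlt | hlast | hgt
  · simp only [deviationPotential, endRound_count_arm, if_pos hlt,
      if_pos (Nat.lt_of_succ_lt hlt)]
    rw [lintegral_add_right _ measurable_const, lintegral_const, measure_univ, mul_one]
    gcongr
    exact lintegral_chernoffBound_endRound_le hs hν hκ x j
  · exact lintegral_deviationPotential_endRound_of_last_play_le hs hν hε hκ hx hy hlast
  · have hzero : ∀ p : ℝ × ℝ,
        deviationPotential s.arm j (mean ν s.arm) κ x y ε (endRound s p.1 p.2) = 0 := by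
      intro p
      have hcount := endRound_count_arm s p.1 p.2
      rw [deviationPotential, if_neg (by lia), if_neg fun hdev => by have := hdev.1; lia]
    simp only [hzero, lintegral_zero, zero_le]

lemma deviationPotential_initState_le [NeZero K] :
    deviationPotential a j μ κ x y ε (initState K) ≤
      ENNReal.ofReal (Real.exp (-((2 ^ j : ℕ) * x ^ 2))) +
        ENNReal.ofReal (Real.exp (-(ε * (2 ^ j : ℕ) * y / 2))) := by
  have hblock : ((2 ^ j : ℕ) : ℝ) ≤ 2 * (2 ^ j - 2 ^ j / 2 : ℕ) := by
    exact_mod_cast (by lia : 2 ^ j ≤ 2 * (2 ^ j - 2 ^ j / 2))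
  have hsum : blockSum a j (initState K) = 0 := if_pos (Nat.zero_le _)
  rw [deviationPotential, if_pos (show (initState K).count a < 2 ^ j from Nat.two_pow_pos j),
    chernoffBound, hsum]
  simp only [initState, Nat.zero_sub, Nat.cast_zero]
  gcongr
  linarith [mul_le_mul_of_nonneg_right hblock (sq_nonneg x)]

theorem measure_deviates_le [NeZero K] {σ : ArgmaxRule K} {α : ℝ}
    (hν : ∀ a, ∀ᵐ r ∂(ν a), r ∈ Set.Icc (0 : ℝ) 1) (hε : 0 < ε) (hκ : |κ| = 1) (hx : 0 ≤ x)
    (hy : 0 ≤ y) (a : Fin K) (j n : ℕ) :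
    law σ α ε ν n {h | Deviates a (2 ^ j) (mean ν a) κ (x + y) (state σ α ε n h)} ≤
      ENNReal.ofReal (Real.exp (-((2 ^ j : ℕ) * x ^ 2))) +
        ENNReal.ofReal (Real.exp (-(ε * (2 ^ j : ℕ) * y / 2))) := by
  have hmeas := fun n => measState_state σ α ε n
  have hdev := (hmeas n).measurableSet_deviates a (2 ^ j) (mean ν a) κ (x + y)
  calc _ = ∫⁻ h, {h | Deviates a (2 ^ j) (mean ν a) κ (x + y) (state σ α ε n h)}.indicator 1 h
        ∂(law σ α ε ν n) := (lintegral_indicator_one hdev).symm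
    _ ≤ ∫⁻ h, deviationPotential a j (mean ν a) κ x y ε (state σ α ε n h) ∂(law σ α ε ν n) := by
        refine lintegral_mono (Set.indicator_le fun h hh => ?_)
        rw [deviationPotential, if_neg (by rw [hh.1]; exact lt_irrefl _),
          if_pos (by exact hh)]
        exact le_rfl
    _ ≤ deviationPotential a j (mean ν a) κ x y ε (initState K) := by
        refine lintegral_state_le (fun n => (hmeas n).measurable_deviationPotential ..)
          (fun n h => ?_) n
        have hreach := reachable_state σ α ε n h
        exact (lintegral_deviationPotential_endRound_le (hreach.ready σ α ε) (hν _) hε hκ hx hy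
          a j).trans_eq (deviationPotential_beginRound hreach σ α)
    _ ≤ _ := deviationPotential_initState_le

end Potential

/-- The width of the confidence interval in `index`: `N` is the number of plays of the arm and `t`
the round in which the episode starts. -/
def radius (α ε : ℝ) (t N : ℕ) : ℝ :=
  Real.sqrt (α * Real.log t / (2 * (1 / 2 * (N : ℝ)))) +
    α * Real.log t / (ε * (1 / 2 * (N : ℝ)))

lemma index_eq_privMean_add_radius (α ε : ℝ) (t : ℕ) (s : State K) (a : Fin K) :
    index α ε t s a = s.privMean a + radius α ε t (s.count a) := by
  rw [index, radius, add_assoc]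

theorem measure_deviates_radius_le [NeZero K] {σ : ArgmaxRule K} {α ε κ : ℝ}
    {ν : Fin K → Measure ℝ} [∀ a, IsProbabilityMeasure (ν a)]
    (hν : ∀ a, ∀ᵐ r ∂(ν a), r ∈ Set.Icc (0 : ℝ) 1) (hα : 0 ≤ α) (hε : 0 < ε) (hκ : |κ| = 1)
    (a : Fin K) (j n : ℕ) :
    law σ α ε ν n {h | Deviates a (2 ^ j) (mean ν a) κ (radius α ε (n + 1) (2 ^ j))
      (state σ α ε n h)} ≤ ENNReal.ofReal (2 * ((n + 1 : ℕ) : ℝ) ^ (-α)) := by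
  set L := α * Real.log ((n + 1 : ℕ) : ℝ) with hL
  have _ : 0 ≤ L := mul_nonneg hα (Real.log_natCast_nonneg _)
  have hpow : Real.exp (-L) = ((n + 1 : ℕ) : ℝ) ^ (-α) := by
    rw [Real.rpow_def_of_pos (by positivity), hL]
    congr 1
    ring
  refine (measure_deviates_le hν hε hκ (Real.sqrt_nonneg _) (by positivity) a j n).trans_eq ?_
  rw [Real.sq_sqrt (by positivity), ← hpow, two_mul (Real.exp _),
    ENNReal.ofReal_add (by positivity) (by positivity), ← hL]
  congr 4 <;> field_simp

/-! ### The number of plays of an arm -/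

lemma sum_rpow_neg_le {s : ℝ} (hs : 1 < s) (n : ℕ) :
    ∑ i ∈ Finset.range n, ((i + 2 : ℕ) : ℝ) ^ (-s) ≤ 1 / (s - 1) := by
  have hanti : AntitoneOn (fun x : ℝ => x ^ (-s)) (Set.Icc 1 (1 + (n : ℝ))) := fun x hx y _ hxy =>
    Real.rpow_le_rpow_of_nonpos (by linarith [hx.1]) hxy (by linarith)
  have hzero : (0 : ℝ) ∉ Set.uIcc (1 : ℝ) (1 + n) := by
    rw [Set.uIcc_of_le (by linarith [Nat.cast_nonneg (α := ℝ) n])]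
    exact fun h => absurd h.1 (by norm_num)
  calc ∑ i ∈ Finset.range n, ((i + 2 : ℕ) : ℝ) ^ (-s)
      = ∑ i ∈ Finset.range n, (1 + ((i + 1 : ℕ) : ℝ)) ^ (-s) := by
        refine Finset.sum_congr rfl fun i _ => ?_
        push_cast
        ring_nf
    _ ≤ ∫ x in (1 : ℝ)..1 + n, x ^ (-s) := hanti.sum_le_integral
    _ = (1 - (1 + (n : ℝ)) ^ (-s + 1)) / (s - 1) := by
        rw [integral_rpow (Or.inr ⟨by linarith, hzero⟩), Real.one_rpow, ← neg_div_neg_eq]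
        congr 1 <;> ring
    _ ≤ 1 / (s - 1) := by
        have : 0 ≤ (1 + (n : ℝ)) ^ (-s + 1) := by positivity
        gcongr
        linarith

lemma sum_sq_mul_rpow_neg_le {α : ℝ} (hα : 3 < α) (n : ℕ) :
    ∑ i ∈ Finset.range n, (i : ℝ) ^ 2 * ((i + 1 : ℕ) : ℝ) ^ (-α) ≤ 1 / (α - 3) := by
  rcases n with - | m
  · simpa using hα.le
  have hterm : ∀ i : ℕ, ((i + 1 : ℕ) : ℝ) ^ 2 * ((i + 2 : ℕ) : ℝ) ^ (-α) ≤
      ((i + 2 : ℕ) : ℝ) ^ (-(α - 2)) := by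
    intro i
    rw [neg_sub, sub_eq_add_neg, Real.rpow_add (by positivity), Real.rpow_two]
    gcongr
    lia
  rw [Finset.sum_range_succ', Nat.cast_zero, zero_pow two_ne_zero, zero_mul, add_zero]
  refine (Finset.sum_le_sum fun i _ => hterm i).trans
    ((sum_rpow_neg_le (by linarith) m).trans_eq ?_)
  congr 1
  ring

section BadHistories

variable [NeZero K]

/-- The histories after which the private mean of arm `a` is too large, or that of arm `b` too
small. In a history of `n` rounds that completes an episode, the numbers of plays are powers of two
less than `2 ^ n`. -/
def badHistories (σ : ArgmaxRule K) (α ε : ℝ) (ν : Fin K → Measure ℝ) (a b : Fin K) (n : ℕ) :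
    Set (Fin n → Round K) :=
  ⋃ j ∈ Finset.range n,
    {h | Deviates a (2 ^ j) (mean ν a) 1 (radius α ε (n + 1) (2 ^ j)) (state σ α ε n h)} ∪
    {h | Deviates b (2 ^ j) (mean ν b) (-1) (radius α ε (n + 1) (2 ^ j)) (state σ α ε n h)}

/-- A bound for the number of plays in the episodes that start after a bad history: an episode that
starts after `n` rounds has at most `n` rounds. -/
def badPlays (σ : ArgmaxRule K) (α ε : ℝ) (ν : Fin K → Measure ℝ) (a b : Fin K) :
    ∀ n, (Fin n → Round K) → ℝ :=
  historySum fun n => (badHistories σ α ε ν a b n).indicator fun _ => (n : ℝ)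

variable {σ : ArgmaxRule K} {α ε : ℝ} {ν : Fin K → Measure ℝ}

lemma measurableSet_badHistories (a b : Fin K) (n : ℕ) :
    MeasurableSet (badHistories σ α ε ν a b n) :=
  Finset.measurableSet_biUnion _ fun _ _ =>
    ((measState_state σ α ε n).measurableSet_deviates ..).union
      ((measState_state σ α ε n).measurableSet_deviates ..)

lemma badPlays_nonneg (a b : Fin K) (n : ℕ) (h : Fin n → Round K) :
    0 ≤ badPlays σ α ε ν a b n h :=
  historySum_nonneg (fun n h => Set.indicator_nonneg (fun _ _ => n.cast_nonneg) h) n h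

variable [∀ a, IsProbabilityMeasure (ν a)]

lemma measureReal_badHistories_le (hν : ∀ a, ∀ᵐ x ∂(ν a), x ∈ Set.Icc (0 : ℝ) 1) (hα : 0 ≤ α)
    (hε : 0 < ε) (a b : Fin K) (n : ℕ) :
    (law σ α ε ν n).real (badHistories σ α ε ν a b n) ≤ 4 * (n * ((n + 1 : ℕ) : ℝ) ^ (-α)) := by
  have hdev : ∀ κ : ℝ, |κ| = 1 → ∀ (c : Fin K) (j : ℕ),
      (law σ α ε ν n).real {h | Deviates c (2 ^ j) (mean ν c) κ (radius α ε (n + 1) (2 ^ j))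
        (state σ α ε n h)} ≤ 2 * ((n + 1 : ℕ) : ℝ) ^ (-α) := fun κ hκ c j =>
    ENNReal.toReal_le_of_le_ofReal (by positivity)
      (measure_deviates_radius_le hν hα hε hκ c j n)
  calc (law σ α ε ν n).real (badHistories σ α ε ν a b n)
      ≤ ∑ j ∈ Finset.range n, 4 * ((n + 1 : ℕ) : ℝ) ^ (-α) := by
        refine (measureReal_biUnion_finset_le _ _).trans
          (Finset.sum_le_sum fun j _ => (measureReal_union_le _ _).trans ?_)
        linarith [hdev 1 abs_one a j, hdev (-1) (by rw [abs_neg, abs_one]) b j]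
    _ = 4 * (n * ((n + 1 : ℕ) : ℝ) ^ (-α)) := by
        rw [Finset.sum_const, Finset.card_range, nsmul_eq_mul]
        ring

lemma integrable_indicator_badHistories (a b : Fin K) (n : ℕ) :
    Integrable ((badHistories σ α ε ν a b n).indicator fun _ => (n : ℝ)) (law σ α ε ν n) :=
  (integrable_const _).indicator (measurableSet_badHistories a b n)

lemma integrable_badPlays (a b : Fin K) (n : ℕ) :
    Integrable (badPlays σ α ε ν a b n) (law σ α ε ν n) :=
  integrable_historySum (integrable_indicator_badHistories a b) n

theorem integral_badPlays_le (hν : ∀ a, ∀ᵐ x ∂(ν a), x ∈ Set.Icc (0 : ℝ) 1) (hα : 3 < α)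
    (hε : 0 < ε) (a b : Fin K) (n : ℕ) :
    ∫ h, badPlays σ α ε ν a b n h ∂(law σ α ε ν n) ≤ 4 / (α - 3) := by
  calc ∫ h, badPlays σ α ε ν a b n h ∂(law σ α ε ν n)
      = ∑ i ∈ Finset.range n, (law σ α ε ν i).real (badHistories σ α ε ν a b i) * i := by
        refine (integral_historySum (integrable_indicator_badHistories a b) n).trans
          (Finset.sum_congr rfl fun i _ => ?_)
        rw [integral_indicator_const _ (measurableSet_badHistories a b i), smul_eq_mul]
    _ ≤ ∑ i ∈ Finset.range n, 4 * (i * ((i + 1 : ℕ) : ℝ) ^ (-α)) * i := by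
        gcongr with i
        exact measureReal_badHistories_le hν (by linarith) hε a b i
    _ = 4 * ∑ i ∈ Finset.range n, (i : ℝ) ^ 2 * ((i + 1 : ℕ) : ℝ) ^ (-α) := by
        rw [Finset.mul_sum]
        exact Finset.sum_congr rfl fun i _ => by ring
    _ ≤ 4 * (1 / (α - 3)) := by
        gcongr
        exact sum_sq_mul_rpow_neg_le hα n
    _ = 4 / (α - 3) := by ring

end BadHistories

lemma natCast_mul_radius {α ε : ℝ} (hε : 0 < ε) (t : ℕ) {N : ℕ} (hN : 0 < N) :
    (N : ℝ) * radius α ε t N = Real.sqrt (α * N * Real.log t) + 2 * α * Real.log t / ε := by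
  have hN' : (0 : ℝ) < N := by exact_mod_cast hN
  rw [radius, mul_add]
  congr 1
  · nth_rewrite 1 [← Real.sqrt_sq hN'.le]
    rw [← Real.sqrt_mul (by positivity)]
    congr 1
    field_simp
  · field_simp

lemma gap_nonneg (ν : Fin K → Measure ℝ) (a : Fin K) : 0 ≤ gap ν a :=
  sub_nonneg.2 (le_ciSup (Set.finite_range (mean ν)).bddAbove a)

lemma gap_le_two_mul_radius {α ε : ℝ} {ν : Fin K → Measure ℝ} {a b : Fin K}
    (hb : mean ν b = bestMean ν) {t : ℕ} {s : State K}
    (hindex : index α ε t s b ≤ index α ε t s a)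
    (hdev_a : ¬ Deviates a (s.count a) (mean ν a) 1 (radius α ε t (s.count a)) s)
    (hdev_b : ¬ Deviates b (s.count b) (mean ν b) (-1) (radius α ε t (s.count b)) s) :
    gap ν a ≤ 2 * radius α ε t (s.count a) := by
  have ha : 1 * (s.privMean a - mean ν a) ≤ radius α ε t (s.count a) :=
    not_lt.1 fun hlt => hdev_a ⟨rfl, hlt⟩
  have hb' : -1 * (s.privMean b - mean ν b) ≤ radius α ε t (s.count b) :=
    not_lt.1 fun hlt => hdev_b ⟨rfl, hlt⟩
  rw [index_eq_privMean_add_radius, index_eq_privMean_add_radius] at hindex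
  rw [gap, ← hb]
  linarith

/-- The number of plays of arm `a` at the end of the current episode. -/
def committed (a : Fin K) (s : State K) : ℕ := if a = s.arm then s.goal else s.count a

lemma committed_endRound (a : Fin K) (s : State K) (r z : ℝ) :
    committed a (endRound s r z) = committed a s := by
  unfold committed
  rw [endRound_count_apply]
  simp only [endRound]
  split_ifs <;> rfl

namespace Reachable

variable {n : ℕ} {s : State K}

lemma count_le_committed (hs : Reachable n s) (a : Fin K) : s.count a ≤ committed a s := by
  rw [committed]
  split_ifs with harm
  · rcases eq_or_ne n 0 with hn | hn
    · simp [hs.count_of_le (by lia) a, hn]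
    · obtain ⟨c, hcount, hgoal, -⟩ := hs.episode hn
      rw [harm, hcount, hgoal]
      exact lt_blockEnd c
  · exact le_rfl

lemma committed_beginRound [NeZero K] (hs : Reachable n s) (σ : ArgmaxRule K) (α ε : ℝ)
    (a : Fin K) :
    committed a (beginRound σ α ε n s) ≤ max 1 (committed a s) ∨
      committed a (beginRound σ α ε n s) = 2 * s.count a ∧
        σ.select (index α ε (n + 1) s) = a ∧ ∀ c, 0 < s.count c ∧ IsBlockStart (s.count c) := by
  by_cases harm : a = (beginRound σ α ε n s).arm
  swap
  · refine Or.inl (le_max_of_le_right ?_)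
    rw [committed, if_neg harm, beginRound_count]
    exact hs.count_le_committed a
  by_cases hK : n < K
  · refine Or.inl (le_max_of_le_left ?_)
    rw [committed, if_pos harm]
    simp [beginRound, hK]
  by_cases hgoal : s.count s.arm < s.goal
  · refine Or.inl (le_max_of_le_right (le_of_eq ?_))
    simp [beginRound, hK, hgoal]
  · have hn : n ≠ 0 := by have := NeZero.ne K; lia
    have hselect : σ.select (index α ε (n + 1) s) = a := by
      rw [harm]; simp [beginRound, hK, hgoal]
    refine Or.inr ⟨?_, hselect, fun c => ⟨hs.one_le_count (not_lt.1 hK) c,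
      hs.isBlockStart_of_goal_le hn (not_lt.1 hgoal) c⟩⟩
    rw [committed, if_pos harm]
    simp [beginRound, hK, hgoal, hselect]

end Reachable

section GapMulCount

variable [NeZero K] {σ : ArgmaxRule K} {α ε : ℝ} {ν : Fin K → Measure ℝ} {a b : Fin K}

lemma not_deviates_of_notMem_badHistories {n : ℕ} {h : Fin n → Round K}
    (hblock : ∀ c, 0 < (state σ α ε n h).count c ∧ IsBlockStart ((state σ α ε n h).count c))
    (hgood : h ∉ badHistories σ α ε ν a b n) :
    let s := state σ α ε n h
    ¬ Deviates a (s.count a) (mean ν a) 1 (radius α ε (n + 1) (s.count a)) s ∧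
      ¬ Deviates b (s.count b) (mean ν b) (-1) (radius α ε (n + 1) (s.count b)) s := by
  intro s
  have hpow : ∀ c, ∃ j < n, s.count c = 2 ^ j := by
    intro c
    obtain ⟨j, hj⟩ := (hblock c).2.exists_eq_two_pow (hblock c).1
    refine ⟨j, ?_, hj⟩
    have hle : s.count c ≤ n := count_state_le h c
    exact (Nat.lt_two_pow_self.trans_eq hj.symm).trans_le hle
  simp only [badHistories, Set.mem_iUnion, Finset.mem_range, not_exists, Set.mem_union,
    not_or] at hgood
  obtain ⟨i, hi, hia⟩ := hpow a
  obtain ⟨j, hj, hjb⟩ := hpow b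
  rw [hia, hjb]
  exact ⟨(hgood i hi).1, (hgood j hj).2⟩

lemma mul_two_mul_le_of_le_two_mul_radius (hα : 0 ≤ α) (hε : 0 < ε) {Δ : ℝ} {t T c N : ℕ}
    (hΔ : Δ ≤ 2 * radius α ε t c) (ht : 0 < t) (htT : t ≤ T) (hc : 0 < c) (hcN : c ≤ N) :
    Δ * (2 * c) ≤ 4 * Real.sqrt (α * N * Real.log T) + 8 * α * Real.log T / ε := by
  have hlog : Real.log t ≤ Real.log T := Real.log_le_log (mod_cast ht) (mod_cast htT)
  have _ : 0 ≤ Real.log t := Real.log_natCast_nonneg t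
  calc Δ * (2 * c) ≤ 2 * radius α ε t c * (2 * c) := by gcongr
    _ = 4 * (c * radius α ε t c) := by ring
    _ = 4 * Real.sqrt (α * c * Real.log t) + 8 * α * Real.log t / ε := by
        rw [natCast_mul_radius hε t hc]
        ring
    _ ≤ 4 * Real.sqrt (α * N * Real.log T) + 8 * α * Real.log T / ε := by gcongr

lemma committed_roundState_le_or_gap_mul_le (hα : 0 ≤ α) (hε : 0 < ε)
    (hb : mean ν b = bestMean ν) {T N n : ℕ} (hn : n < T) (h : Fin n → Round K)
    (hN : (state σ α ε n h).count a ≤ N) :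
    committed a (roundState σ α ε n h) ≤ max 1 (committed a (state σ α ε n h)) ∨
      (h ∈ badHistories σ α ε ν a b n ∧
        committed a (roundState σ α ε n h) ≤ committed a (state σ α ε n h) + n) ∨
      gap ν a * committed a (roundState σ α ε n h) ≤
        4 * Real.sqrt (α * N * Real.log T) + 8 * α * Real.log T / ε := by
  have hreach := reachable_state σ α ε n h
  rcases hreach.committed_beginRound σ α ε a with hle | ⟨htwice, hselect, hblock⟩
  · exact Or.inl hle
  by_cases hbad : h ∈ badHistories σ α ε ν a b n
  · refine Or.inr (Or.inl ⟨hbad, htwice.trans_le ?_⟩)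
    rw [two_mul]
    exact add_le_add (hreach.count_le_committed a) (count_state_le h a)
  · have ⟨hdev_a, hdev_b⟩ := not_deviates_of_notMem_badHistories hblock hbad
    have hindex := σ.le_select (index α ε (n + 1) (state σ α ε n h)) b
    rw [hselect] at hindex
    have hgap := gap_le_two_mul_radius hb hindex hdev_a hdev_b
    refine Or.inr (Or.inr ?_)
    rw [roundState, htwice, Nat.cast_mul, Nat.cast_two]
    exact mul_two_mul_le_of_le_two_mul_radius hα hε hgap n.succ_pos hn (hblock a).1 hN

lemma gap_mul_committed_le (hα : 0 ≤ α) (hε : 0 < ε) (hb : mean ν b = bestMean ν) {T N n : ℕ}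
    (hn : n ≤ T) (h : Fin n → Round K) (hN : (state σ α ε n h).count a ≤ N) :
    gap ν a * committed a (state σ α ε n h) ≤ gap ν a * (1 + badPlays σ α ε ν a b n h) +
      (4 * Real.sqrt (α * N * Real.log T) + 8 * α * Real.log T / ε) := by
  have hgap := gap_nonneg ν a
  have _ := Real.log_natCast_nonneg T
  set M := 4 * Real.sqrt (α * N * Real.log T) + 8 * α * Real.log T / ε
  have hM : 0 ≤ M := by positivity
  induction n with
  | zero =>
    have hzero : committed a (state σ α ε 0 h) = 0 := ite_self 0
    rw [hzero, Nat.cast_zero, mul_zero]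
    have := badPlays_nonneg (σ := σ) (α := α) (ε := ε) (ν := ν) a b 0 h
    positivity
  | succ n ih =>
    set g := Fin.init h
    have hcount : (state σ α ε n g).count a ≤ N := by
      rw [state_succ, endRound_count_apply, roundState_count] at hN
      exact (Nat.le_add_right ..).trans hN
    specialize ih (by lia) g hcount
    have hplays : 0 ≤ badPlays σ α ε ν a b (n + 1) h := badPlays_nonneg a b (n + 1) h
    have hsucc : badPlays σ α ε ν a b (n + 1) h = badPlays σ α ε ν a b n g +
      (badHistories σ α ε ν a b n).indicator (fun _ => (n : ℝ)) g := rfl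
    have hle : badPlays σ α ε ν a b n g ≤ badPlays σ α ε ν a b (n + 1) h :=
      hsucc ▸ le_add_of_nonneg_right (Set.indicator_nonneg (fun _ _ => n.cast_nonneg) g)
    rw [state_succ, committed_endRound]
    rcases committed_roundState_le_or_gap_mul_le hα hε hb hn g hcount with
      hmax | ⟨hbad, hadd⟩ | hgood
    · rcases le_max_iff.1 hmax with hone | hsame
      · have : (committed a (roundState σ α ε n g) : ℝ) ≤ 1 := mod_cast hone
        nlinarith
      · have : (committed a (roundState σ α ε n g) : ℝ) ≤ committed a (state σ α ε n g) :=
          mod_cast hsame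
        nlinarith
    · have : (committed a (roundState σ α ε n g) : ℝ) ≤ committed a (state σ α ε n g) + n :=
        mod_cast hadd
      rw [hsucc, Set.indicator_of_mem hbad]
      nlinarith
    · exact hgood.trans (le_add_of_nonneg_left (by positivity))

theorem gap_mul_count_le (hα : 0 ≤ α) (hε : 0 < ε) (hb : mean ν b = bestMean ν) (T : ℕ)
    (h : Fin T → Round K) :
    gap ν a * (state σ α ε T h).count a ≤ gap ν a * (1 + badPlays σ α ε ν a b T h) +
      (4 * Real.sqrt (α * (state σ α ε T h).count a * Real.log T) + 8 * α * Real.log T / ε) := by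
  refine le_trans ?_ (gap_mul_committed_le hα hε hb le_rfl h le_rfl)
  exact mul_le_mul_of_nonneg_left
    (mod_cast (reachable_state σ α ε T h).count_le_committed a) (gap_nonneg ν a)

end GapMulCount

/-! ### The regret bound -/

/-- The bound `B_T(ν)` for the regret of AdaP-UCB at horizon `T`. -/
def regretBound (α ε : ℝ) (ν : Fin K → Measure ℝ) (T : ℕ) : ℝ :=
  3 * α / (α - 3) * ∑ a, gap ν a + 8 * Real.sqrt (α * K * T * Real.log T)
    + 16 * α * K * Real.log T / ε

lemma sum_sqrt_le_sqrt_card_mul_sum {ι : Type*} [Fintype ι] {f : ι → ℝ} (hf : ∀ i, 0 ≤ f i) :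
    ∑ i, Real.sqrt (f i) ≤ Real.sqrt (Fintype.card ι * ∑ i, f i) := by
  refine Real.le_sqrt_of_sq_le (sq_sum_le_card_mul_sum_sq.trans_eq ?_)
  simp only [Real.sq_sqrt (hf _), Finset.card_univ]

section Regret

variable [NeZero K] {σ : ArgmaxRule K} {α ε : ℝ} {ν : Fin K → Measure ℝ}

lemma sum_sqrt_count_le (hα : 0 ≤ α) {T : ℕ} (h : Fin T → Round K) :
    ∑ a, Real.sqrt (α * (state σ α ε T h).count a * Real.log T) ≤
      Real.sqrt (α * K * T * Real.log T) := by
  have _ := Real.log_natCast_nonneg T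
  refine (sum_sqrt_le_sqrt_card_mul_sum fun a => by positivity).trans_eq ?_
  rw [← Finset.sum_mul, ← Finset.mul_sum, ← Nat.cast_sum, sum_count_state, Fintype.card_fin]
  congr 1
  ring

lemma sum_gap_mul_count_le (hα : 0 ≤ α) (hε : 0 < ε) {b : Fin K} (hb : mean ν b = bestMean ν)
    {T : ℕ} (h : Fin T → Round K) :
    ∑ a, gap ν a * (state σ α ε T h).count a ≤ ∑ a, gap ν a * (1 + badPlays σ α ε ν a b T h) +
      (4 * Real.sqrt (α * K * T * Real.log T) + 8 * α * K * Real.log T / ε) := by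
  refine (Finset.sum_le_sum fun a _ => gap_mul_count_le hα hε hb T h).trans ?_
  rw [Finset.sum_add_distrib, Finset.sum_add_distrib, ← Finset.mul_sum, Finset.sum_const,
    Finset.card_univ, Fintype.card_fin, nsmul_eq_mul,
    show (K : ℝ) * (8 * α * Real.log T / ε) = 8 * α * K * Real.log T / ε by ring]
  gcongr
  exact sum_sqrt_count_le hα h

variable [∀ a, IsProbabilityMeasure (ν a)]

theorem regret_eq_integral_sum_gap_mul_count (hν : ∀ a, ∀ᵐ x ∂(ν a), x ∈ Set.Icc (0 : ℝ) 1)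
    (T : ℕ) :
    regret σ α ε ν T = ∫ h, ∑ a, gap ν a * (state σ α ε T h).count a ∂(law σ α ε ν T) := by
  have hbest : ∀ h : Fin T → Round K,
      ∑ a, bestMean ν * ((state σ α ε T h).count a : ℝ) = T * bestMean ν := by
    intro h
    rw [← Finset.mul_sum, ← Nat.cast_sum, sum_count_state, mul_comm]
  simp only [gap, sub_mul, Finset.sum_sub_distrib]
  rw [regret, integral_sum_reward hν, integral_sub (integrable_sum_mul_count _ T)
    (integrable_sum_mul_count _ T)]
  simp only [hbest, integral_const, probReal_univ, one_smul]

theorem regret_le (hν : ∀ a, ∀ᵐ x ∂(ν a), x ∈ Set.Icc (0 : ℝ) 1) (hα : 3 < α) (hε : 0 < ε)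
    (T : ℕ) :
    regret σ α ε ν T ≤ (1 + 4 / (α - 3)) * ∑ a, gap ν a +
      (4 * Real.sqrt (α * K * T * Real.log T) + 8 * α * K * Real.log T / ε) := by
  have hα0 : 0 ≤ α := by linarith
  obtain ⟨b, hb⟩ := exists_eq_ciSup_of_finite (f := mean ν)
  have hint (a : Fin K) : Integrable (fun h => 1 + badPlays σ α ε ν a b T h) (law σ α ε ν T) :=
    (integrable_const 1).add (integrable_badPlays a b T)
  have hsum : Integrable (fun h => ∑ a, gap ν a * (1 + badPlays σ α ε ν a b T h))
      (law σ α ε ν T) :=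
    integrable_finsetSum _ fun a _ => (hint a).const_mul _
  set M := 4 * Real.sqrt (α * K * T * Real.log T) + 8 * α * K * Real.log T / ε
  have hplays (a : Fin K) :
      ∫ h, 1 + badPlays σ α ε ν a b T h ∂(law σ α ε ν T) ≤ 1 + 4 / (α - 3) := by
    rw [integral_add (integrable_const 1) (integrable_badPlays a b T), integral_const,
      probReal_univ, one_smul]
    gcongr
    exact integral_badPlays_le hν hα hε a b T
  calc regret σ α ε ν T
      ≤ ∫ h, (∑ a, gap ν a * (1 + badPlays σ α ε ν a b T h) + M) ∂(law σ α ε ν T) := by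
        rw [regret_eq_integral_sum_gap_mul_count hν]
        exact integral_mono (integrable_sum_mul_count _ T) (hsum.add (integrable_const M))
          (sum_gap_mul_count_le hα0 hε hb)
    _ = ∑ a, gap ν a * ∫ h, 1 + badPlays σ α ε ν a b T h ∂(law σ α ε ν T) + M := by
        rw [integral_add hsum (integrable_const M), integral_const, probReal_univ, one_smul,
          integral_finsetSum _ fun a _ => (hint a).const_mul _]
        simp only [integral_const_mul]
    _ ≤ ∑ a, gap ν a * (1 + 4 / (α - 3)) + M := by
        gcongr with a
        · exact gap_nonneg ν a
        · exact hplays a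
    _ = (1 + 4 / (α - 3)) * ∑ a, gap ν a + M := by rw [← Finset.sum_mul, mul_comm]

theorem regret_le_regretBound (hν : ∀ a, ∀ᵐ x ∂(ν a), x ∈ Set.Icc (0 : ℝ) 1) (hα : 3 < α)
    (hε : 0 < ε) (T : ℕ) : regret σ α ε ν T ≤ regretBound α ε ν T := by
  have hα3 : 0 < α - 3 := sub_pos.2 hα
  have hcoef : 1 + 4 / (α - 3) ≤ 3 * α / (α - 3) := by
    rw [one_add_div hα3.ne']
    gcongr
    linarith
  have hgap : 0 ≤ ∑ a, gap ν a := Finset.sum_nonneg fun a _ => gap_nonneg ν a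
  have _ := Real.log_natCast_nonneg T
  refine (regret_le hν hα hε T).trans ?_
  rw [regretBound, add_assoc]
  gcongr <;> norm_num

end Regret

/-! ### Comparison with the minimax lower bound -/

section Minimax

variable {α ε : ℝ} {ν : Fin K → Measure ℝ} {T : ℕ}

lemma mean_mem_Icc [∀ a, IsProbabilityMeasure (ν a)]
    (hν : ∀ a, ∀ᵐ x ∂(ν a), x ∈ Set.Icc (0 : ℝ) 1) (a : Fin K) :
    mean ν a ∈ Set.Icc (0 : ℝ) 1 :=
  (convex_Icc 0 1).integral_mem isClosed_Icc (hν a) (.of_mem_Icc 0 1 aemeasurable_id' (hν a))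

lemma sum_gap_le [NeZero K] [∀ a, IsProbabilityMeasure (ν a)]
    (hν : ∀ a, ∀ᵐ x ∂(ν a), x ∈ Set.Icc (0 : ℝ) 1) : ∑ a, gap ν a ≤ (K : ℝ) - 1 := by
  obtain ⟨b, hb⟩ := exists_eq_ciSup_of_finite (f := mean ν)
  have hgap_b : gap ν b = 0 := sub_eq_zero.2 hb.symm
  have hgap_le : ∀ a, gap ν a ≤ 1 := by
    intro a
    rw [gap, bestMean, ← hb]
    linarith [(mean_mem_Icc hν a).1, (mean_mem_Icc hν b).2]
  rw [← Finset.add_sum_erase _ _ (Finset.mem_univ b), hgap_b, zero_add]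
  refine (Finset.sum_le_card_nsmul _ _ 1 fun a _ => hgap_le a).trans_eq ?_
  rw [Finset.card_erase_of_mem (Finset.mem_univ b), Finset.card_univ, Fintype.card_fin,
    nsmul_eq_mul, mul_one, Nat.cast_sub NeZero.one_le, Nat.cast_one]

lemma sqrt_mul_sub_one_le_minimaxLowerBound (K T : ℕ) (ε : ℝ) :
    Real.sqrt (T * ((K : ℝ) - 1)) ≤ 27 * minimaxLowerBound K T ε := by
  have := le_max_left (1 / 27 * Real.sqrt (T * ((K : ℝ) - 1))) (1 / 131 * (((K : ℝ) - 1) / ε))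
  rw [minimaxLowerBound]
  linarith

lemma sub_one_div_le_minimaxLowerBound (K T : ℕ) (ε : ℝ) :
    ((K : ℝ) - 1) / ε ≤ 131 * minimaxLowerBound K T ε := by
  have := le_max_right (1 / 27 * Real.sqrt (T * ((K : ℝ) - 1))) (1 / 131 * (((K : ℝ) - 1) / ε))
  rw [minimaxLowerBound]
  linarith

lemma minimaxLowerBound_nonneg (K T : ℕ) (ε : ℝ) : 0 ≤ minimaxLowerBound K T ε :=
  le_max_of_le_left (by positivity)

lemma half_le_log_natCast (hT : 2 ≤ T) : 1 / 2 ≤ Real.log T := by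
  have : Real.log 2 ≤ Real.log T := Real.log_le_log two_pos (mod_cast hT)
  linarith [Real.log_two_gt_d9]

lemma sub_one_le_sqrt (hK : 1 ≤ K) (hKT : K - 1 ≤ T) :
    (K : ℝ) - 1 ≤ Real.sqrt (T * ((K : ℝ) - 1)) := by
  rw [← Nat.cast_one, ← Nat.cast_sub hK]
  refine Real.le_sqrt_of_sq_le ?_
  rw [sq]
  gcongr

lemma sqrt_mul_log_le (hα : 0 ≤ α) (hK : 2 ≤ K) (hT : 2 ≤ T) :
    Real.sqrt (α * K * T * Real.log T) ≤
      2 * Real.sqrt (2 * α) * Real.log T * Real.sqrt (T * ((K : ℝ) - 1)) := by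
  have hlog := half_le_log_natCast hT
  have hK' : (2 : ℝ) ≤ K := mod_cast hK
  have hK_sub : (K : ℝ) ≤ 2 * (K - 1) := by linarith
  have hlog_sq : Real.log T ≤ (2 * Real.log T) ^ 2 := by nlinarith
  calc Real.sqrt (α * K * T * Real.log T)
      ≤ Real.sqrt (α * (2 * (K - 1)) * T * (2 * Real.log T) ^ 2) := by
        have : 0 ≤ (K : ℝ) - 1 := by linarith
        gcongr
    _ = Real.sqrt (2 * α * (T * (K - 1)) * (2 * Real.log T) ^ 2) := by
        congr 1
        ring
    _ = 2 * Real.sqrt (2 * α) * Real.log T * Real.sqrt (T * ((K : ℝ) - 1)) := by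
        rw [Real.sqrt_mul' _ (sq_nonneg _), Real.sqrt_sq (by linarith),
          Real.sqrt_mul (by positivity)]
        ring

theorem regretBound_le_mul_minimaxLowerBound [∀ a, IsProbabilityMeasure (ν a)]
    (hν : ∀ a, ∀ᵐ x ∂(ν a), x ∈ Set.Icc (0 : ℝ) 1) (hα : 3 < α) (hε : 0 < ε) (hK : 2 ≤ K)
    (hT : 2 ≤ T) (hKT : K - 1 ≤ T) :
    regretBound α ε ν T ≤ (54 * (3 * α / (α - 3)) + 432 * Real.sqrt (2 * α) + 4192 * α) *
      Real.log T * minimaxLowerBound K T ε := by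
  have : NeZero K := ⟨by lia⟩
  have hK' : (2 : ℝ) ≤ K := mod_cast hK
  have hlog := half_le_log_natCast hT
  have _ : 0 < α - 3 := sub_pos.2 hα
  have hsqrt := sqrt_mul_sub_one_le_minimaxLowerBound K T ε
  have hdiv := sub_one_div_le_minimaxLowerBound K T ε
  have hM := minimaxLowerBound_nonneg K T ε
  set M := minimaxLowerBound K T ε
  have hgap_term : 3 * α / (α - 3) * ∑ a, gap ν a ≤
      54 * (3 * α / (α - 3)) * Real.log T * M := by
    calc 3 * α / (α - 3) * ∑ a, gap ν a ≤ 3 * α / (α - 3) * (27 * M * (2 * Real.log T)) := by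
          gcongr
          have hgap := (sum_gap_le hν).trans (sub_one_le_sqrt (by lia) hKT)
          nlinarith
      _ = _ := by ring
  have hsqrt_term : 8 * Real.sqrt (α * K * T * Real.log T) ≤
      432 * Real.sqrt (2 * α) * Real.log T * M := by
    calc 8 * Real.sqrt (α * K * T * Real.log T)
        ≤ 8 * (2 * Real.sqrt (2 * α) * Real.log T * (27 * M)) := by
          grw [sqrt_mul_log_le (by linarith) hK hT, hsqrt]
      _ = _ := by ring
  have hprivacy_term : 16 * α * K * Real.log T / ε ≤ 4192 * α * Real.log T * M := by
    calc 16 * α * K * Real.log T / ε ≤ 16 * α * (2 * ((K : ℝ) - 1)) * Real.log T / ε := by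
          gcongr
          linarith
      _ = 32 * α * Real.log T * (((K : ℝ) - 1) / ε) := by ring
      _ ≤ 32 * α * Real.log T * (131 * M) := by gcongr
      _ = _ := by ring
  rw [regretBound]
  linarith

end Minimax

end AdaP

end

theorem mainTheorem11 (α : ℝ) (hα : 3 < α) :
    (∀ (K : ℕ) [NeZero K] (σ : AdaP.ArgmaxRule K) (ε : ℝ) (_ : 0 < ε)
        (ν : Fin K → MeasureTheory.Measure ℝ) [∀ a, MeasureTheory.IsProbabilityMeasure (ν a)]
        (_ : ∀ a, ∀ᵐ x ∂(ν a), x ∈ Set.Icc (0 : ℝ) 1) (T : ℕ),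
        AdaP.regret σ α ε ν T ≤
          3 * α / (α - 3) * ∑ a, AdaP.gap ν a
            + 8 * Real.sqrt (α * K * T * Real.log T)
            + 16 * α * K * Real.log T / ε) ∧
    (∃ C : ℝ, 0 < C ∧
      ∀ (K : ℕ) (_ : 2 ≤ K) (ε : ℝ) (_ : 0 < ε)
        (ν : Fin K → MeasureTheory.Measure ℝ) [∀ a, MeasureTheory.IsProbabilityMeasure (ν a)]
        (_ : ∀ a, ∀ᵐ x ∂(ν a), x ∈ Set.Icc (0 : ℝ) 1) (T : ℕ) (_ : 2 ≤ T) (_ : K - 1 ≤ T),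
        3 * α / (α - 3) * ∑ a, AdaP.gap ν a
            + 8 * Real.sqrt (α * K * T * Real.log T)
            + 16 * α * K * Real.log T / ε ≤
          C * Real.log T * AdaP.minimaxLowerBound K T ε) := by
  refine ⟨fun K _ σ ε hε ν _ hν T => AdaP.regret_le_regretBound hν hα hε T,
    54 * (3 * α / (α - 3)) + 432 * Real.sqrt (2 * α) + 4192 * α, ?_,
    fun K hK ε hε ν _ hν T hT hKT =>
      AdaP.regretBound_le_mul_minimaxLowerBound hν hα hε hK hT hKT⟩
  have : 0 < α - 3 := sub_pos.2 hα
  positivity
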